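/- Let $\mathcal{L}^{\mathrm{II}}$ be monadic full second-order logic: first-order logic together with second-order variables $X, Y, \dots$ ranging over all subsets of the underlying set of a structure, and atomic formulas $x \mathrel{\varepsilon} X$. A theory (set of $\mathcal{L}^{\mathrm{II}}$-sentences) $T$ is satisfiable if it has a model, and ${<}\kappa$-satisfiable if every $T_0 \subseteq T$ with $|T_0| < \kappa$ is satisfiable. Let $\mathrm{WCS}(\mathcal{L}^{\mathrm{II}})$ be the class of all cardinals $\kappa > \aleph_0$ such that every ${<}\kappa$-satisfiable $\mathcal{L}^{\mathrm{II}}$-theory in a signature with at most $\kappa$ many non-logical symbols is satisfiable. For sets $M, N$ (regarded as structures $\langle M, \in\rangle$, $\langle N,\in\rangle$) and an ordinal $\mu$, write $j : M \preceq_\mu N$ if $\mu + 1 \subseteq M$, $\mu+1 \subseteq N$, and $j : M \to N$ is a first-order elementary embedding with $j \restriction \mu = \mathrm{id}_\mu$ and $j(\mu) > \mu$. A cardinal $\kappa$ is weakly sub-extendible if for every ordinal $\theta > \kappa$ and every $M \prec V_\theta$ with $\kappa + 1 \subseteq M$ and $|M| = \kappa$ there are an ordinal $\bar\theta$, some $\mu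 \le \kappa$ and some $j : M \preceq_\mu V_{\bar\theta}$ such that $j(\kappa) > \sup (j''\kappa)$. Theorem. Let $\kappa$ be an infinite cardinal. If $\kappa$ is regular, then $\kappa \in \mathrm{WCS}(\mathcal{L}^{\mathrm{II}})$ if and only if $\kappa$ is weakly sub-extendible. Moreover, the implication from right to left holds for every infinite cardinal $\kappa$, regular or not: if $\kappa$ is weakly sub-extendible, then $\kappa \in \mathrm{WCS}(\mathcal{L}^{\mathrm{II}})$. -/

import Mathlib

universe u

open FirstOrder Cardinal
open scoped ZFSet

namespace WeakCompactness

/-! ### Monadic full second-order logic -/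

/-- Formulas of monadic second-order logic over the signature `L`, with `n` free first-order
variables and `m` free second-order variables. The formula `mem x X` is the atomic formula
`x ε X`. -/
inductive MSOFormula (L : FirstOrder.Language.{u, u}) : ℕ → ℕ → Type u
  | falsum {n m : ℕ} : MSOFormula L n m
  | equal {n m : ℕ} (s t : L.Term (Fin n)) : MSOFormula L n m
  | rel {n m k : ℕ} (R : L.Relations k) (ts : Fin k → L.Term (Fin n)) : MSOFormula L n m
  | mem {n m : ℕ} (x : Fin n) (X : Fin m) : MSOFormula L n m
  | imp {n m : ℕ} (φ ψ : MSOFormula L n m) : MSOFormula L n m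
  | all {n m : ℕ} (φ : MSOFormula L (n + 1) m) : MSOFormula L n m
  | allSet {n m : ℕ} (φ : MSOFormula L n (m + 1)) : MSOFormula L n m

/-- Full semantics: the second-order variables range over all subsets of the structure. -/
def MSOFormula.Realize {L : FirstOrder.Language.{u, u}} {A : Type u} [L.Structure A] :
    {n m : ℕ} → MSOFormula L n m → (Fin n → A) → (Fin m → Set A) → Prop
  | _, _, .falsum, _, _ => False
  | _, _, .equal s t, v, _ => s.realize v = t.realize v
  | _, _, .rel R ts, v, _ => FirstOrder.Language.Structure.RelMap R fun i => (ts i).realize v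
  | _, _, .mem x X, v, V => v x ∈ V X
  | _, _, .imp φ ψ, v, V => φ.Realize v V → ψ.Realize v V
  | _, _, .all φ, v, V => ∀ a : A, φ.Realize (Fin.snoc (α := fun _ => A) v a) V
  | _, _, .allSet φ, v, V => ∀ B : Set A, φ.Realize v (Fin.snoc (α := fun _ => Set A) V B)

/-- Sentences of monadic second-order logic. -/
abbrev MSOSentence (L : FirstOrder.Language.{u, u}) : Type u := MSOFormula L 0 0

/-- `A ⊨ φ` for a sentence `φ` of monadic second-order logic. -/
def MSOSentence.Holds {L : FirstOrder.Language.{u, u}} (φ : MSOSentence L) (A : Type u) [L.Structure A] :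
    Prop :=
  MSOFormula.Realize (A := A) φ Fin.elim0 Fin.elim0

/-- A theory is satisfiable if it has a (nonempty) model. -/
def Satisfiable {L : FirstOrder.Language.{u, u}} (T : Set (MSOSentence L)) : Prop :=
  ∃ (A : Type u) (_ : Nonempty A) (_ : L.Structure A), ∀ φ ∈ T, MSOSentence.Holds φ A

/-- A theory is `< κ`-satisfiable if all its subsets of cardinality less than `κ` are
satisfiable. -/
def LTSatisfiable {L : FirstOrder.Language.{u, u}} (κ : Cardinal.{u}) (T : Set (MSOSentence L)) : Prop :=
  ∀ T₀ ⊆ T, #T₀ < κ → Satisfiable T₀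

/-- The weak compactness spectrum of monadic second-order logic. -/
def WCS : Set Cardinal.{u} :=
  {κ | ℵ₀ < κ ∧ ∀ L : FirstOrder.Language.{u, u}, L.card ≤ κ →
    ∀ T : Set (MSOSentence L), LTSatisfiable κ T → Satisfiable T}

/-! ### Sets as first-order `∈`-structures -/

/-- The only relation symbol of the language of set theory, which is binary. -/
inductive SetRel : ℕ → Type
  | mem : SetRel 2

/-- The language of set theory. -/
def setLang : FirstOrder.Language.{0, 0} := ⟨fun _ => Empty, SetRel⟩

/-- Every set `x` is regarded as the structure `⟨x, ∈⟩`. -/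
instance setStructure (x : ZFSet.{u}) : setLang.Structure x where
  funMap := fun f => Empty.elim f
  RelMap := fun r => match r with
    | SetRel.mem => fun v => (v 0 : ZFSet.{u}) ∈ (v 1 : ZFSet.{u})

/-- `M ≺ N`: the set `M` is a subset of `N`, and the inclusion is elementary for first-order
formulas. -/
def IsElementarySubmodel (M N : ZFSet.{u}) : Prop :=
  ∃ e : M ↪ₑ[setLang] N, ∀ x : M, (e x : ZFSet.{u}) = x

/-- `j : M ≼_μ N`: `μ + 1` is a subset of `M` and of `N`, and the elementary embedding `j` is the
identity on `μ` and satisfies `j(μ) > μ`. (Ordinals are von Neumann ordinals, so `<` is `∈`.) -/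
def HasCriticalPoint {M N : ZFSet.{u}} (j : M ↪ₑ[setLang] N) (μ : Ordinal.{u}) : Prop :=
  (μ + 1).toZFSet ⊆ M ∧ (μ + 1).toZFSet ⊆ N ∧
    (∀ x : M, (x : ZFSet.{u}) ∈ μ.toZFSet → (j x : ZFSet.{u}) = x) ∧
    ∃ m : M, (m : ZFSet.{u}) = μ.toZFSet ∧ μ.toZFSet ∈ (j m : ZFSet.{u})

/-- `sup (j '' α)` for an ordinal `α`, the supremum of a set of von Neumann ordinals being its
union. -/
noncomputable def supImage {M N : ZFSet.{u}} (j : M ↪ₑ[setLang] N) (α : Ordinal.{u}) :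
    ZFSet.{u} :=
  ⋃ x : {x : M // (x : ZFSet.{u}) ∈ α.toZFSet}, (j x.1 : ZFSet.{u})

/-- `κ` is weakly sub-extendible: for all `θ > κ` and all `M ≺ V_θ` with `κ + 1 ⊆ M` and
`|M| = κ`, there are `θ'`, `μ ≤ κ` and `j : M ≼_μ V_θ'` with `j(κ) > sup (j '' κ)`. -/
def WeaklySubExtendible (κ : Cardinal.{u}) : Prop :=
  ∀ θ : Ordinal.{u}, κ.ord < θ → ∀ M : ZFSet.{u}, IsElementarySubmodel M (V_ θ) →
    (κ.ord + 1).toZFSet ⊆ M → M.card = κ →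
    ∃ (θ' : Ordinal.{u}) (j : M ↪ₑ[setLang] (V_ θ' : ZFSet.{u})),
      (∃ μ ≤ κ.ord, HasCriticalPoint j μ) ∧
      ∃ k : M, (k : ZFSet.{u}) = κ.ord.toZFSet ∧ supImage j κ.ord ∈ (j k : ZFSet.{u})

end WeakCompactness

/-!
For the implication from right to left, let `T` be a `< κ`-satisfiable theory. There are at most `κ`
sentences (`mk_msoFormula_le`), so `T` is numbered by ordinals below `κ`, and for each `δ < κ` there
is a model `A δ` of the sentences with numbers below `δ`. All these models, together with ordinals
below `κ` that code the symbols, are coded in one set `W` (`exists_graph`), and `W` belongs to some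
`M ≺ V_θ` of size `κ` (`exists_elementarySubmodel`). Since `V_θ` contains all subsets of the
structures in it, each monadic second-order sentence about a coded structure translates into a
first-order formula about `V_θ` (`MSOFormula.expressible`); no internal notion of syntax is needed.
If `φ ∈ T` has number `α`, then `M` knows that `φ` holds in `A δ` for all `δ` with `α < δ < κ`. Hence
on the side of `V_θ'` it holds in the structure with index `δ` whenever `j(α) < δ < j(κ)`, and
`δ = sup (j '' κ)` is such an index for all `α < κ` at once (`realize_supImage`). This structure is
a model of `T`. That `κ` is uncountable follows because the nonzero elements of `ω` have largest
elements, while `sup (j '' ω)` has none (`WeaklySubExtendible.aleph0_lt`).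

For the converse, let `κ` be regular and `M ≺ V_θ`. Being isomorphic to some `V_θ'` is a monadic
second-order property (`rankSentence`, `rankLike_of_equiv`, `RankLike.exists_equiv`). Add this
sentence to the elementary diagram of `M`, with the statements `d ∈ κ` and `α ∈ d` for all `α < κ`,
where `d` is a new constant. In fewer than `κ` of these sentences only boundedly
many `α` occur, so `V_θ` is a model, and weak compactness yields an elementary `j : M → V_θ'` with
`j '' κ` bounded by `d < j(κ)`. The least ordinal moved by `j` is its critical point
(`exists_criticalPoint`).
-/

namespace WeakCompactness

/-! ### The number of monadic second-order formulas -/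

section Counting

variable (L : FirstOrder.Language.{u, u})

/-- The label of the root of a monadic second-order formula, seen as a finitely branching
well-founded tree. The numbers of free variables are recorded only where terms need them. -/
inductive FormulaLabel : Type u
  | falsum
  | equal (n : ℕ) (s t : L.Term (Fin n))
  | rel (n k : ℕ) (R : L.Relations k) (ts : List (L.Term (Fin n)))
  | mem (x X : ℕ)
  | imp
  | all
  | allSet

/-- The number of immediate subformulas below a given label. -/
def FormulaLabel.arity {L : FirstOrder.Language.{u, u}} : FormulaLabel L → ℕ
  | .imp => 2
  | .all => 1
  | .allSet => 1
  | _ => 0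

/-- The syntax tree of a monadic second-order formula. -/
def MSOFormula.toTree {L : FirstOrder.Language.{u, u}} :
    {n m : ℕ} → MSOFormula L n m → WType fun l : FormulaLabel L => Fin l.arity
  | _, _, .falsum => ⟨.falsum, Fin.elim0⟩
  | n, _, .equal s t => ⟨.equal n s t, Fin.elim0⟩
  | n, _, .rel (k := k) R ts => ⟨.rel n k R (List.ofFn ts), Fin.elim0⟩
  | _, _, .mem x X => ⟨.mem x X, Fin.elim0⟩
  | _, _, .imp φ ψ => ⟨.imp, ![φ.toTree, ψ.toTree]⟩
  | _, _, .all φ => ⟨.all, ![φ.toTree]⟩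
  | _, _, .allSet φ => ⟨.allSet, ![φ.toTree]⟩

theorem MSOFormula.toTree_injective {L : FirstOrder.Language.{u, u}} {n m : ℕ}
    (φ ψ : MSOFormula L n m) (h : φ.toTree = ψ.toTree) : φ = ψ := by
  induction φ with
  | falsum => cases ψ <;> injection h with h₁ h₂ <;> first | rfl | cases h₁
  | equal s t =>
    cases ψ <;> injection h with h₁ h₂ <;> cases h₁
    rfl
  | rel R ts =>
    cases ψ <;> injection h with h₁ h₂ <;> first | injection h₁; done | skip
    injection h₁ with h₃ h₄ h₅ h₆
    subst h₄
    rw [eq_of_heq h₅, List.ofFn_injective h₆]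
  | mem x X =>
    cases ψ <;> injection h with h₁ h₂ <;> first | injection h₁; done | skip
    injection h₁ with h₃ h₄
    rw [Fin.ext h₃, Fin.ext h₄]
  | imp φ₁ φ₂ ih₁ ih₂ =>
    cases ψ <;> injection h with h₁ h₂ <;> first | injection h₁; done | skip
    rw [ih₁ _ (congrFun h₂ 0), ih₂ _ (congrFun h₂ 1)]
  | all φ ih =>
    cases ψ <;> injection h with h₁ h₂ <;> first | injection h₁; done | skip
    rw [ih _ (congrFun h₂ 0)]
  | allSet φ ih =>
    cases ψ <;> injection h with h₁ h₂ <;> first | injection h₁; done | skip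
    rw [ih _ (congrFun h₂ 0)]

variable {L}

theorem mk_term_le {κ : Cardinal.{u}} (hκ : ℵ₀ ≤ κ) (hL : L.card ≤ κ) (n : ℕ) :
    #(L.Term (Fin n)) ≤ κ := by
  refine Language.Term.card_le.trans (max_le hκ ?_)
  rw [mk_sum]
  refine add_le_of_le hκ ?_ ?_
  · simpa using (natCast_lt_aleph0 (n := n)).le.trans hκ
  · rw [lift_id']
    refine le_trans ?_ hL
    rw [Language.card, Language.Symbols, mk_sum]
    simp

theorem mk_relations_le {κ : Cardinal.{u}} (hL : L.card ≤ κ) : #(Σ k, L.Relations k) ≤ κ := by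
  refine le_trans ?_ hL
  rw [Language.card, Language.Symbols, mk_sum]
  simp

theorem mk_formulaLabel_le {κ : Cardinal.{u}} (hκ : ℵ₀ ≤ κ) (hL : L.card ≤ κ) :
    #(FormulaLabel L) ≤ κ := by
  have hsig : ∀ F : ℕ → Type u, (∀ n, #(F n) ≤ κ) → #(Σ n, F n) ≤ κ := by
    intro F hF
    rw [mk_sigma]
    refine (sum_le_lift_mk_mul_iSup _).trans ?_
    refine mul_le_of_le hκ (by simpa using hκ) ?_
    exact ciSup_le' hF
  have hmul : ∀ X Y : Type u, #X ≤ κ → #Y ≤ κ → #(X × Y) ≤ κ := fun X Y hX hY => by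
    rw [mk_prod, lift_id, lift_id]; exact mul_le_of_le hκ hX hY
  have hadd : ∀ X Y : Type u, #X ≤ κ → #Y ≤ κ → #(X ⊕ Y) ≤ κ := fun X Y hX hY => by
    rw [mk_sum, lift_id, lift_id]; exact add_le_of_le hκ hX hY
  have hlist : ∀ X : Type u, #X ≤ κ → #(List X) ≤ κ := fun X hX =>
    (mk_list_le_max X).trans (max_le hκ hX)
  have hT := mk_term_le hκ hL
  let Y := (Σ n, L.Term (Fin n) × L.Term (Fin n)) ⊕
    ((Σ n, (Σ k, L.Relations k) × List (L.Term (Fin n))) ⊕ ULift.{u} (Option (Option (ℕ × ℕ)) ⊕ Bool))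
  have hY : #Y ≤ κ := by
    refine hadd _ _ (hsig _ fun n => hmul _ _ (hT n) (hT n))
      (hadd _ _ (hsig _ fun n => hmul _ _ (mk_relations_le hL) (hlist _ (hT n))) ?_)
    refine le_trans ?_ hκ
    exact mk_le_aleph0
  let f : Y → FormulaLabel L
    | .inl ⟨n, s, t⟩ => .equal n s t
    | .inr (.inl ⟨n, ⟨k, R⟩, ts⟩) => .rel n k R ts
    | .inr (.inr ⟨.inl (some (some (x, X)))⟩) => .mem x X
    | .inr (.inr ⟨.inl none⟩) => .falsum
    | .inr (.inr ⟨.inl (some none)⟩) => .imp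
    | .inr (.inr ⟨.inr true⟩) => .all
    | .inr (.inr ⟨.inr false⟩) => .allSet
  have hf : Function.Surjective f := by
    intro l
    cases l with
    | falsum => exact ⟨.inr (.inr ⟨.inl none⟩), rfl⟩
    | equal n s t => exact ⟨.inl ⟨n, s, t⟩, rfl⟩
    | rel n k R ts => exact ⟨.inr (.inl ⟨n, ⟨k, R⟩, ts⟩), rfl⟩
    | mem x X => exact ⟨.inr (.inr ⟨.inl (some (some (x, X)))⟩), rfl⟩
    | imp => exact ⟨.inr (.inr ⟨.inl (some none)⟩), rfl⟩
    | all => exact ⟨.inr (.inr ⟨.inr true⟩), rfl⟩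
    | allSet => exact ⟨.inr (.inr ⟨.inr false⟩), rfl⟩
  exact (mk_le_of_surjective hf).trans hY

theorem mk_msoFormula_le {κ : Cardinal.{u}} (hκ : ℵ₀ ≤ κ) (hL : L.card ≤ κ) (n m : ℕ) :
    #(MSOFormula L n m) ≤ κ :=
  (mk_le_of_injective (f := MSOFormula.toTree (L := L) (n := n) (m := m))
    fun φ ψ h => MSOFormula.toTree_injective φ ψ h).trans <|
    WType.cardinalMk_le_max_aleph0_of_finite'.trans <|
      max_le (by simpa using mk_formulaLabel_le hκ hL) hκ

end Counting

/-! ### First-order formulas of set theory -/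

section SetFormulas

variable {α : Type*}

/-- The formula `vᵢ ∈ vⱼ`. -/
def memF (i j : α) : setLang.Formula α :=
  Language.Relations.formula₂ (SetRel.mem : setLang.Relations 2) (.var i) (.var j)

/-- The formula `vᵢ = vⱼ`. -/
def eqF (i j : α) : setLang.Formula α :=
  Language.Term.equal (.var i) (.var j)

/-- Universal quantification over the variable `none`. -/
noncomputable def allF (φ : setLang.Formula (Option α)) : setLang.Formula α :=
  (φ.relabel fun o => o.elim (Sum.inr ()) Sum.inl).iAlls Unit

/-- Existential quantification over the variable `none`. -/
noncomputable def exF (φ : setLang.Formula (Option α)) : setLang.Formula α :=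
  (φ.relabel fun o => o.elim (Sum.inr ()) Sum.inl).iExs Unit

variable {U : ZFSet.{u}} {v : α → U}

@[simp] theorem realize_memF {i j : α} :
    (memF i j).Realize v ↔ (v i : ZFSet.{u}) ∈ (v j : ZFSet.{u}) := by
  exact Language.Formula.realize_rel₂.trans Iff.rfl

@[simp] theorem realize_eqF {i j : α} : (eqF i j).Realize v ↔ v i = v j := by
  simp [eqF]

@[simp] theorem realize_allF {φ : setLang.Formula (Option α)} :
    (allF φ).Realize v ↔ ∀ a : U, φ.Realize fun o => o.elim a v := by
  rw [allF, Language.Formula.realize_iAlls]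
  refine ⟨fun h a => ?_, fun h i => ?_⟩
  · have := h fun _ => a
    rw [Language.Formula.realize_relabel] at this
    convert this using 1
    ext o; cases o <;> rfl
  · rw [Language.Formula.realize_relabel]
    convert h (i ()) using 1
    ext o; cases o <;> rfl

@[simp] theorem realize_exF {φ : setLang.Formula (Option α)} :
    (exF φ).Realize v ↔ ∃ a : U, φ.Realize fun o => o.elim a v := by
  rw [exF, Language.Formula.realize_iExs]
  refine ⟨fun ⟨i, h⟩ => ⟨i (), ?_⟩, fun ⟨a, h⟩ => ⟨fun _ => a, ?_⟩⟩
  · rw [Language.Formula.realize_relabel] at h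
    convert h using 1
    ext o; cases o <;> rfl
  · rw [Language.Formula.realize_relabel]
    convert h using 1
    ext o; cases o <;> rfl

/-- The formula `vᵢ = {vⱼ, vₖ}`. -/
noncomputable def unorderedPairF (i j k : α) : setLang.Formula α :=
  allF ((memF none (some i)).iff (eqF none (some j) ⊔ eqF none (some k)))

/-- The formula `vᵢ = (vⱼ, vₖ)`, for Kuratowski pairs. -/
noncomputable def pairF (i j k : α) : setLang.Formula α :=
  exF (memF none (some i) ⊓ unorderedPairF none (some j) (some j)) ⊓
    (exF (memF none (some i) ⊓ unorderedPairF none (some j) (some k)) ⊓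
    allF ((memF none (some i)).imp
      (unorderedPairF none (some j) (some j) ⊔ unorderedPairF none (some j) (some k))))

theorem realize_unorderedPairF (hU : U.IsTransitive) {i j k : α} :
    (unorderedPairF i j k).Realize v ↔ (v i : ZFSet.{u}) = {(v j : ZFSet.{u}), (v k : ZFSet.{u})} := by
  simp only [unorderedPairF, realize_allF, Language.Formula.realize_iff, realize_memF,
    Language.Formula.realize_sup, realize_eqF, Option.elim_none, Option.elim_some]
  constructor
  · intro h
    ext z
    rw [ZFSet.mem_pair]
    constructor
    · intro hz
      simpa [Subtype.ext_iff] using (h ⟨z, hU.mem_trans hz (v i).2⟩).1 hz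
    · rintro (rfl | rfl)
      · exact (h (v j)).2 (Or.inl rfl)
      · exact (h (v k)).2 (Or.inr rfl)
  · intro h a
    rw [h, ZFSet.mem_pair, Subtype.ext_iff, Subtype.ext_iff]

theorem realize_pairF (hU : U.IsTransitive) {i j k : α} :
    (pairF i j k).Realize v ↔ (v i : ZFSet.{u}) = ZFSet.pair (v j) (v k) := by
  simp only [pairF, realize_allF, realize_exF, Language.Formula.realize_inf, realize_memF,
    Language.Formula.realize_imp, realize_unorderedPairF hU,
    Language.Formula.realize_sup, Option.elim_none, Option.elim_some, ZFSet.pair_eq_singleton]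
  constructor
  · rintro ⟨⟨a, ha, ha'⟩, ⟨b, hb, hb'⟩, h⟩
    ext z
    rw [ZFSet.pair, ZFSet.mem_pair]
    constructor
    · intro hz
      exact h ⟨z, hU.mem_trans hz (v i).2⟩ hz
    · rintro (rfl | rfl)
      · rwa [← ha']
      · rwa [← hb']
  · intro h
    have h₁ : ({(v j : ZFSet.{u})} : ZFSet.{u}) ∈ (v i : ZFSet.{u}) := by simp [h, ZFSet.pair]
    have h₂ : ({(v j : ZFSet.{u}), (v k : ZFSet.{u})} : ZFSet.{u}) ∈ (v i : ZFSet.{u}) := by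
      simp [h, ZFSet.pair]
    refine ⟨⟨⟨_, hU.mem_trans h₁ (v i).2⟩, h₁, rfl⟩, ⟨⟨_, hU.mem_trans h₂ (v i).2⟩, h₂, rfl⟩, ?_⟩
    intro a ha
    simpa [h, ZFSet.pair] using ha

/-- Finite sequences of sets, coded as iterated Kuratowski pairs ending in `∅`. -/
def tup (l : List ZFSet.{u}) : ZFSet.{u} := l.foldr ZFSet.pair ∅

theorem pair_ne_empty (x y : ZFSet.{u}) : ZFSet.pair x y ≠ ∅ := fun h => by
  have : ({x} : ZFSet.{u}) ∈ ZFSet.pair x y := by simp [ZFSet.pair]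
  exact ZFSet.notMem_empty _ (h ▸ this)

theorem tup_injective : Function.Injective tup.{u} := by
  intro l
  induction l with
  | nil =>
    intro l' h
    cases l' with
    | nil => rfl
    | cons b l' => exact absurd h.symm (pair_ne_empty _ _)
  | cons a l ih =>
    intro l' h
    cases l' with
    | nil => exact absurd h (pair_ne_empty _ _)
    | cons b l' =>
      obtain ⟨rfl, h'⟩ :=
        ZFSet.pair_injective (show ZFSet.pair a (tup l) = ZFSet.pair b (tup l') from h)
      rw [ih h']

theorem mem_of_pair_mem (hU : U.IsTransitive) {x y : ZFSet.{u}} (h : ZFSet.pair x y ∈ U) :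
    x ∈ U ∧ y ∈ U := by
  have : ({x, y} : ZFSet.{u}) ∈ U := hU.mem_trans (y := ZFSet.pair x y) (by simp [ZFSet.pair]) h
  exact ⟨hU.mem_trans (y := {x, y}) (by simp) this, hU.mem_trans (y := {x, y}) (by simp) this⟩

theorem mem_of_tup_mem (hU : U.IsTransitive) {l : List ZFSet.{u}} (h : tup l ∈ U) {x : ZFSet.{u}}
    (hx : x ∈ l) : x ∈ U := by
  induction l with
  | nil => simp at hx
  | cons a l ih =>
    obtain ⟨h₁, h₂⟩ := mem_of_pair_mem hU h
    rcases List.mem_cons.1 hx with rfl | hx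
    exacts [h₁, ih h₂ hx]

/-- The formula `v = tup (v_{l₀}, v_{l₁}, …)`, where `v` is the variable `none`. -/
noncomputable def eqTupF : List α → setLang.Formula (Option α)
  | [] => allF (memF none (some none)).not
  | k :: l => exF (pairF (some none) (some (some k)) none ⊓
      (eqTupF l).relabel (fun o => o.elim none (some ∘ some)))

theorem realize_eqTupF (hU : U.IsTransitive) (l : List α) (a : U) :
    ((eqTupF l).Realize fun o => o.elim a v) ↔
      (a : ZFSet.{u}) = tup (l.map fun k => (v k : ZFSet.{u})) := by
  induction l generalizing a with
  | nil =>
    simp only [eqTupF, realize_allF, Language.Formula.realize_not, realize_memF, Option.elim_none,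
      Option.elim_some, List.map_nil, tup, List.foldr_nil, ZFSet.eq_empty]
    exact ⟨fun h y hy => h ⟨y, hU.mem_trans hy a.2⟩ hy, fun h y => h y⟩
  | cons k l ih =>
    simp only [eqTupF, realize_exF, Language.Formula.realize_inf, realize_pairF hU,
      Language.Formula.realize_relabel, Option.elim_none, Option.elim_some]
    have key : ∀ b : U, ((fun o : Option (Option α) => o.elim b fun o => o.elim a v) ∘
        fun o : Option α => o.elim none (some ∘ some)) = fun o => o.elim b v := by
      intro b; ext o; cases o <;> rfl
    simp only [key, ih]
    constructor
    · rintro ⟨b, h, h'⟩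
      rw [h, h']
      rfl
    · intro h
      have hb : ZFSet.pair (v k) (tup (l.map fun k => (v k : ZFSet.{u}))) ∈ U := by
        have := a.2
        rwa [h] at this
      exact ⟨⟨_, (mem_of_pair_mem hU hb).2⟩, h, rfl⟩

/-- The formula `tup (v_{l₀}, v_{l₁}, …) ∈ vᵢ`. -/
noncomputable def tupMemF (l : List α) (i : α) : setLang.Formula α :=
  exF (memF none (some i) ⊓ eqTupF l)

theorem realize_tupMemF (hU : U.IsTransitive) {l : List α} {i : α} :
    (tupMemF l i).Realize v ↔ tup (l.map fun k => (v k : ZFSet.{u})) ∈ (v i : ZFSet.{u}) := by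
  simp only [tupMemF, realize_exF, Language.Formula.realize_inf, realize_memF, realize_eqTupF hU,
    Option.elim_none, Option.elim_some]
  constructor
  · rintro ⟨a, h, h'⟩
    rwa [← h']
  · intro h
    exact ⟨⟨_, hU.mem_trans h (v i).2⟩, h, rfl⟩

end SetFormulas

/-! ### Translating monadic second-order logic into first-order set theory -/

section Translation

variable {L : FirstOrder.Language.{u, u}}

/-- The parameters that describe an `L`-structure inside a rank `V_θ`. A single set, the `graph`,
holds a family of structures at once: it consists of tuples `(d, c, a₀, a₁, …)`, where `d` is the
`index` of a structure in the family and `c` is the code of a `symbol` that is true of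
`(a₀, a₁, …)` in this structure. The additional symbol `none` stands for the domain. -/
inductive Param (L : FirstOrder.Language.{u, u}) : Type u
  | graph
  | index
  | symbol (s : Option L.Symbols)

/-- The set-theoretic parameters `p` describe the structure `A`, whose element `a` is represented by
the set `e a`. -/
structure Codes {θ : Ordinal.{u}} (p : Param L → (V_ θ : ZFSet.{u})) (A : Type u) [L.Structure A]
    (e : A → (V_ θ : ZFSet.{u})) : Prop where
  inj : Function.Injective e
  dom (y : ZFSet.{u}) : tup [(p .index : ZFSet.{u}), (p (.symbol none) : ZFSet.{u}), y] ∈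
    (p .graph : ZFSet.{u}) ↔ ∃ a, (e a : ZFSet.{u}) = y
  fn {k : ℕ} (f : L.Functions k) (x : Fin k → A) (a : A) :
    tup ((p .index : ZFSet.{u}) :: (p (.symbol (some (.inl ⟨k, f⟩))) : ZFSet.{u}) ::
      (e a : ZFSet.{u}) :: List.ofFn fun i => (e (x i) : ZFSet.{u})) ∈ (p .graph : ZFSet.{u}) ↔
        a = Language.Structure.funMap f x
  rel {k : ℕ} (R : L.Relations k) (x : Fin k → A) :
    tup ((p .index : ZFSet.{u}) :: (p (.symbol (some (.inr ⟨k, R⟩))) : ZFSet.{u}) ::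
      List.ofFn fun i => (e (x i) : ZFSet.{u})) ∈ (p .graph : ZFSet.{u}) ↔
        Language.Structure.RelMap R x

/-- The rank `V_θ` contains every set of representatives. -/
theorem Codes.exists_set {θ : Ordinal.{u}} {p : Param L → (V_ θ : ZFSet.{u})} {A : Type u}
    [L.Structure A] {e : A → (V_ θ : ZFSet.{u})} (h : Codes p A e) (X : Set A) :
    ∃ Y : (V_ θ : ZFSet.{u}), ∀ a, (e a : ZFSet.{u}) ∈ (Y : ZFSet.{u}) ↔ a ∈ X := by
  refine ⟨⟨ZFSet.range fun a : X => (e a : ZFSet.{u}), ?_⟩, fun a => ?_⟩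
  · rw [ZFSet.mem_vonNeumann]
    refine lt_of_le_of_lt ?_ (ZFSet.mem_vonNeumann.1 (p .graph).2)
    rw [ZFSet.rank_le_iff]
    intro y hy
    obtain ⟨a, rfl⟩ := ZFSet.mem_range.1 hy
    have hW := ZFSet.rank_lt_of_mem ((h.dom _).2 ⟨a, rfl⟩)
    have := mem_of_tup_mem (ZFSet.isTransitive_vonNeumann _) (ZFSet.mem_vonNeumann.2 hW)
      (x := e a) (by simp)
    exact ZFSet.mem_vonNeumann.1 this
  · simp only [ZFSet.mem_range, Subtype.exists, exists_prop]
    constructor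
    · rintro ⟨b, hb, hba⟩
      rwa [← h.inj (Subtype.ext hba)]
    · exact fun ha => ⟨a, ha, rfl⟩

/-- The property `P` of tuples of elements and of subsets of `L`-structures is expressed,
uniformly for all coded structures, by a first-order formula of set theory. -/
def Expressible {α β : Type} (P : ∀ (A : Type u) (_ : L.Structure A), (α → A) → (β → Set A) → Prop) :
    Prop :=
  ∃ ψ : setLang.Formula (Param L ⊕ (α ⊕ β)), ∀ (θ : Ordinal.{u}) (p : Param L → (V_ θ : ZFSet.{u}))
    (A : Type u) (I : L.Structure A) (e : A → (V_ θ : ZFSet.{u})), Codes p A e →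
    ∀ (x : α → A) (X : β → Set A) (Y : β → (V_ θ : ZFSet.{u})),
      (∀ b a, (e a : ZFSet.{u}) ∈ (Y b : ZFSet.{u}) ↔ a ∈ X b) →
      (ψ.Realize (Sum.elim p (Sum.elim (e ∘ x) Y)) ↔ P A I x X)

namespace Expressible

variable {α α' β β' γ : Type}
  {P Q : ∀ (A : Type u) (_ : L.Structure A), (α → A) → (β → Set A) → Prop}

theorem congr (h : Expressible P) (hPQ : ∀ A I x X, P A I x X ↔ Q A I x X) : Expressible Q := by
  obtain ⟨ψ, hψ⟩ := h
  exact ⟨ψ, fun θ p A I e hc x X Y hY => (hψ θ p A I e hc x X Y hY).trans (hPQ A I x X)⟩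

theorem relabel (h : Expressible P) (f : α → α') (g : β → β') :
    Expressible (L := L) fun A I (x : α' → A) (X : β' → Set A) => P A I (x ∘ f) (X ∘ g) := by
  obtain ⟨ψ, hψ⟩ := h
  refine ⟨ψ.relabel (Sum.map id (Sum.map f g)), fun θ p A I e hc x X Y hY => ?_⟩
  rw [Language.Formula.realize_relabel]
  refine Iff.trans (iff_of_eq (congrArg _ ?_))
    (hψ θ p A I e hc (x ∘ f) (X ∘ g) (Y ∘ g) fun b => hY (g b))
  ext (_ | _ | _) <;> rfl

theorem falsum : Expressible (L := L) fun A _ (_ : α → A) (_ : β → Set A) => False :=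
  ⟨⊥, fun _ _ _ _ _ _ _ _ _ _ => Iff.rfl⟩

theorem imp (hP : Expressible P) (hQ : Expressible Q) :
    Expressible (L := L) fun A I (x : α → A) (X : β → Set A) => P A I x X → Q A I x X := by
  obtain ⟨φ, hφ⟩ := hP
  obtain ⟨ψ, hψ⟩ := hQ
  refine ⟨φ.imp ψ, fun θ p A I e hc x X Y hY => ?_⟩
  rw [Language.Formula.realize_imp, hφ θ p A I e hc x X Y hY, hψ θ p A I e hc x X Y hY]

theorem not (hP : Expressible P) :
    Expressible (L := L) fun A I (x : α → A) (X : β → Set A) => ¬ P A I x X :=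
  hP.imp falsum

theorem and (hP : Expressible P) (hQ : Expressible Q) :
    Expressible (L := L) fun A I (x : α → A) (X : β → Set A) => P A I x X ∧ Q A I x X :=
  (hP.imp hQ.not).not.congr fun _ _ _ _ => by tauto

theorem forall_finite [Finite γ]
    {R : γ → ∀ (A : Type u) (_ : L.Structure A), (α → A) → (β → Set A) → Prop}
    (h : ∀ c, Expressible (R c)) :
    Expressible (L := L) fun A I (x : α → A) (X : β → Set A) => ∀ c, R c A I x X := by
  choose ψ hψ using h
  refine ⟨Language.Formula.iInf ψ, fun θ p A I e hc x X Y hY => ?_⟩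
  rw [Language.Formula.realize_iInf]
  exact forall_congr' fun c => hψ c θ p A I e hc x X Y hY

/-- Quantification over finite tuples of elements, relativized to the domain of the structure. -/
theorem forall_tuple [Finite γ]
    {P : ∀ (A : Type u) (_ : L.Structure A), (α ⊕ γ → A) → (β → Set A) → Prop}
    (h : Expressible P) :
    Expressible (L := L) fun A I (x : α → A) (X : β → Set A) =>
      ∀ y : γ → A, P A I (Sum.elim x y) X := by
  obtain ⟨ψ, hψ⟩ := h
  let D : setLang.Formula ((Param L ⊕ (α ⊕ β)) ⊕ γ) := Language.Formula.iInf fun c : γ =>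
    tupMemF [.inl (.inl .index), .inl (.inl (.symbol none)), .inr c] (.inl (.inl .graph))
  refine ⟨(D.imp (ψ.relabel (Sum.elim (.inl ∘ .inl)
    (Sum.elim (Sum.elim (.inl ∘ .inr ∘ .inl) .inr) (.inl ∘ .inr ∘ .inr))))).iAlls γ,
    fun θ p A I e hc x X Y hY => ?_⟩
  have hD : ∀ z : γ → (V_ θ : ZFSet.{u}),
      D.Realize (Sum.elim (Sum.elim p (Sum.elim (e ∘ x) Y)) z) ↔ ∃ y : γ → A, z = e ∘ y := by
    intro z
    simp only [D, Language.Formula.realize_iInf,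
      realize_tupMemF (ZFSet.isTransitive_vonNeumann θ), List.map_cons, List.map_nil,
      Sum.elim_inl, Sum.elim_inr, hc.dom]
    constructor
    · intro hz
      choose y hy using hz
      exact ⟨y, funext fun c => Subtype.ext (hy c).symm⟩
    · rintro ⟨y, rfl⟩ c
      exact ⟨y c, rfl⟩
  have hR : ∀ y : γ → A, (ψ.relabel (Sum.elim (.inl ∘ .inl)
      (Sum.elim (Sum.elim (.inl ∘ .inr ∘ .inl) .inr) (.inl ∘ .inr ∘ .inr)))).Realize
        (Sum.elim (Sum.elim p (Sum.elim (e ∘ x) Y)) (e ∘ y)) ↔ P A I (Sum.elim x y) X := by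
    intro y
    rw [Language.Formula.realize_relabel, ← hψ θ p A I e hc (Sum.elim x y) X Y hY]
    refine iff_of_eq (congrArg _ ?_)
    ext (_ | (_ | _) | _) <;> rfl
  rw [Language.Formula.realize_iAlls]
  constructor
  · intro h y
    exact (hR y).1 (Language.Formula.realize_imp.1 (h (e ∘ y)) ((hD _).2 ⟨y, rfl⟩))
  · intro h z
    refine Language.Formula.realize_imp.2 fun hz => ?_
    obtain ⟨y, rfl⟩ := (hD z).1 hz
    exact (hR y).2 (h y)

theorem exists_tuple [Finite γ]
    {P : ∀ (A : Type u) (_ : L.Structure A), (α ⊕ γ → A) → (β → Set A) → Prop}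
    (h : Expressible P) :
    Expressible (L := L) fun A I (x : α → A) (X : β → Set A) =>
      ∃ y : γ → A, P A I (Sum.elim x y) X :=
  h.not.forall_tuple.not.congr fun _ _ _ _ => by simp

theorem forall_set
    {P : ∀ (A : Type u) (_ : L.Structure A), (α → A) → (Option β → Set A) → Prop}
    (h : Expressible P) :
    Expressible (L := L) fun A I (x : α → A) (X : β → Set A) =>
      ∀ B : Set A, P A I x fun o => o.elim B X := by
  obtain ⟨ψ, hψ⟩ := h
  refine ⟨allF (ψ.relabel (Sum.elim (some ∘ .inl) (Sum.elim (some ∘ .inr ∘ .inl)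
    fun o => o.elim none (some ∘ .inr ∘ .inr)))), fun θ p A I e hc x X Y hY => ?_⟩
  have key : ∀ (Z : (V_ θ : ZFSet.{u})) (B : Set A),
      (∀ a, (e a : ZFSet.{u}) ∈ (Z : ZFSet.{u}) ↔ a ∈ B) →
      ((ψ.relabel (Sum.elim (some ∘ .inl) (Sum.elim (some ∘ .inr ∘ .inl)
        fun o => o.elim none (some ∘ .inr ∘ .inr)))).Realize
          (fun o => o.elim Z (Sum.elim p (Sum.elim (e ∘ x) Y))) ↔
            P A I x fun o => o.elim B X) := by
    intro Z B hZ
    rw [Language.Formula.realize_relabel, ← hψ θ p A I e hc x (fun o => o.elim B X)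
      (fun o => o.elim Z Y) (by rintro (_ | b); exacts [hZ, hY b])]
    refine iff_of_eq (congrArg _ ?_)
    ext (_ | _ | _ | _) <;> rfl
  rw [realize_allF]
  constructor
  · intro h B
    obtain ⟨Z, hZ⟩ := hc.exists_set B
    exact (key Z B hZ).1 (h Z)
  · intro h Z
    exact (key Z {a | (e a : ZFSet.{u}) ∈ (Z : ZFSet.{u})} fun _ => Iff.rfl).2 (h _)

theorem eq (i j : α) : Expressible (L := L) fun A _ (x : α → A) (_ : β → Set A) => x i = x j :=
  ⟨eqF (.inr (.inl i)) (.inr (.inl j)), fun θ p A I e hc x X Y hY => by simp [hc.inj.eq_iff]⟩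

theorem mem (i : α) (b : β) :
    Expressible (L := L) fun A _ (x : α → A) (X : β → Set A) => x i ∈ X b :=
  ⟨memF (.inr (.inl i)) (.inr (.inr b)), fun θ p A I e hc x X Y hY => by simp [hY]⟩

theorem eq_funMap {k : ℕ} (f : L.Functions k) (i : α) (is : Fin k → α) :
    Expressible (L := L) fun A _ (x : α → A) (_ : β → Set A) =>
      x i = Language.Structure.funMap f (x ∘ is) :=
  ⟨tupMemF (.inl .index :: .inl (.symbol (some (.inl ⟨k, f⟩))) :: .inr (.inl i) ::
      List.ofFn fun j => .inr (.inl (is j))) (.inl .graph), fun θ p A I e hc x X Y hY => by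
    refine Iff.trans ?_ (hc.fn f (x ∘ is) (x i))
    rw [realize_tupMemF (ZFSet.isTransitive_vonNeumann θ)]
    simp [List.map_ofFn, Function.comp_def]⟩

theorem relMap {k : ℕ} (R : L.Relations k) (is : Fin k → α) :
    Expressible (L := L) fun A _ (x : α → A) (_ : β → Set A) =>
      Language.Structure.RelMap R (x ∘ is) :=
  ⟨tupMemF (.inl .index :: .inl (.symbol (some (.inr ⟨k, R⟩))) ::
      List.ofFn fun j => .inr (.inl (is j))) (.inl .graph), fun θ p A I e hc x X Y hY => by
    refine Iff.trans ?_ (hc.rel R (x ∘ is))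
    rw [realize_tupMemF (ZFSet.isTransitive_vonNeumann θ)]
    simp [List.map_ofFn, Function.comp_def]⟩

/-- The equation `x = t` is expressible, by quantifying over the values of the subterms of `t`. -/
theorem eq_term (t : L.Term α) : Expressible (L := L) fun A _ (x : Option α → A) (_ : β → Set A) =>
    x none = t.realize (x ∘ some) := by
  induction t with
  | var i => exact eq none (some i)
  | @func k f ts ih =>
    have h₁ := (forall_finite fun i : Fin k => (ih i).relabel
      (fun o => o.elim (.inr i) (.inl ∘ some) : Option α → Option α ⊕ Fin k) (id : β → β)).and
      (eq_funMap f (.inl none) (.inr : Fin k → Option α ⊕ Fin k))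
    refine h₁.exists_tuple.congr fun A I x X => ?_
    constructor
    · rintro ⟨y, hy, h⟩
      refine h.trans (congrArg _ (funext fun i => ?_))
      exact hy i
    · intro h
      exact ⟨fun i => (ts i).realize (x ∘ some), fun i => rfl, h⟩

end Expressible

/-- Every monadic second-order formula is expressible, because `V_θ` contains all subsets of the
structures that it contains. -/
theorem MSOFormula.expressible {n m : ℕ} (φ : MSOFormula L n m) :
    Expressible (L := L) fun A _ (x : Fin n → A) (X : Fin m → Set A) => φ.Realize x X := by
  induction φ with
  | falsum => exact .falsum
  | @equal n m s t =>
    have h := ((Expressible.eq_term (L := L) (β := Fin m) s).relabel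
      (fun o => o.elim (.inr ()) .inl : Option (Fin n) → Fin n ⊕ Unit) id).and
      ((Expressible.eq_term (L := L) (β := Fin m) t).relabel
      (fun o => o.elim (.inr ()) .inl : Option (Fin n) → Fin n ⊕ Unit) id)
    refine h.exists_tuple.congr fun A I x X => ?_
    constructor
    · rintro ⟨y, h₁, h₂⟩
      exact h₁.symm.trans h₂
    · intro h
      exact ⟨fun _ => s.realize x, rfl, h⟩
  | @rel n m k R ts =>
    have h := (Expressible.forall_finite fun i : Fin k =>
      (Expressible.eq_term (L := L) (β := Fin m) (ts i)).relabel
      (fun o => o.elim (.inr i) .inl : Option (Fin n) → Fin n ⊕ Fin k) id).and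
      (Expressible.relMap R (.inr : Fin k → Fin n ⊕ Fin k))
    refine h.exists_tuple.congr fun A I x X => ?_
    constructor
    · rintro ⟨y, hy, h⟩
      have hy : y = fun i => (ts i).realize x := funext hy
      subst hy
      exact h
    · intro h
      exact ⟨fun i => (ts i).realize x, fun i => rfl, h⟩
  | mem x X => exact .mem x X
  | imp φ ψ ih₁ ih₂ => exact ih₁.imp ih₂
  | @all n m φ ih =>
    refine ((ih.relabel (Fin.lastCases (.inr ()) .inl : Fin (n + 1) → Fin n ⊕ Unit)
      id).forall_tuple).congr fun A I x X => ?_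
    have key : ∀ y : Unit → A, Sum.elim x y ∘
        (Fin.lastCases (.inr ()) .inl : Fin (n + 1) → Fin n ⊕ Unit) =
          Fin.snoc (α := fun _ => A) x (y ()) := by
      intro y
      funext i
      induction i using Fin.lastCases <;> simp
    constructor
    · intro h a
      have := h fun _ => a
      rwa [key] at this
    · intro h y
      have := h (y ())
      rwa [← key] at this
  | @allSet n m φ ih =>
    refine ((ih.relabel id (Fin.lastCases none some : Fin (m + 1) → Option (Fin m))).forall_set).congr
      fun A I x X => ?_
    have key : ∀ B : Set A, (fun o : Option (Fin m) => o.elim B X) ∘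
        (Fin.lastCases none some : Fin (m + 1) → Option (Fin m)) =
          Fin.snoc (α := fun _ => Set A) X B := by
      intro B
      funext i
      induction i using Fin.lastCases <;> simp
    refine forall_congr' fun B => ?_
    rw [key]
    rfl

end Translation

/-! ### Decoding structures -/

section Decoding

variable {L : FirstOrder.Language.{u, u}} {U : ZFSet.{u}}

/-- The set `y` belongs to the domain of the structure described by `p`. -/
def InDomain (p : Param L → U) (y : U) : Prop :=
  tup [(p .index : ZFSet.{u}), (p (.symbol none) : ZFSet.{u}), (y : ZFSet.{u})] ∈
    (p .graph : ZFSet.{u})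

/-- The equation `y = f(x)` holds in the structure described by `p`. -/
def FnHolds (p : Param L → U) {k : ℕ} (f : L.Functions k) (y : U) (x : Fin k → U) : Prop :=
  tup ((p .index : ZFSet.{u}) :: (p (.symbol (some (.inl ⟨k, f⟩))) : ZFSet.{u}) ::
    (y : ZFSet.{u}) :: List.ofFn fun i => (x i : ZFSet.{u})) ∈ (p .graph : ZFSet.{u})

/-- The graph of `f` in the structure described by `p` is the graph of a total function. -/
def FnTotal (p : Param L → U) {k : ℕ} (f : L.Functions k) : Prop :=
  ∀ x : Fin k → U, (∀ i, InDomain p (x i)) →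
    ∃ y, InDomain p y ∧ ∀ z, InDomain p z → (FnHolds p f z x ↔ z = y)

/-- Parameters describe a structure as soon as the domain is nonempty and the function symbols are
interpreted by total functions. -/
theorem exists_codes {θ : Ordinal.{u}} (p : Param L → (V_ θ : ZFSet.{u}))
    (hne : ∃ y, InDomain p y) (hfn : ∀ (k : ℕ) (f : L.Functions k), FnTotal p f) :
    ∃ (A : Type u) (_ : Nonempty A) (_ : L.Structure A) (e : A → (V_ θ : ZFSet.{u})),
      Codes p A e := by
  choose F hF hF' using hfn
  let D := {y : (V_ θ : ZFSet.{u}) // InDomain p y}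
  let s : D ≃ Shrink.{u} D := equivShrink D
  let e : Shrink.{u} D → (V_ θ : ZFSet.{u}) := fun a => (s.symm a).1
  have he : ∀ a, InDomain p (e a) := fun a => (s.symm a).2
  have hinj : Function.Injective e := fun a b h => s.symm.injective (Subtype.ext h)
  have hsurj : ∀ y, InDomain p y → ∃ a, e a = y := fun y hy => ⟨s ⟨y, hy⟩, by simp [e]⟩
  let I : L.Structure (Shrink.{u} D) :=
    { funMap := fun {k} f x => s ⟨F k f (e ∘ x) fun i => he (x i), hF k f _ _⟩
      RelMap := fun {k} R x => tup ((p .index : ZFSet.{u}) ::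
        (p (.symbol (some (.inr ⟨k, R⟩))) : ZFSet.{u}) ::
          List.ofFn fun i => (e (x i) : ZFSet.{u})) ∈ (p .graph : ZFSet.{u}) }
  have hU := ZFSet.isTransitive_vonNeumann θ
  refine ⟨Shrink.{u} D, ?_, I, e, hinj, fun y => ⟨fun hy => ?_, ?_⟩, fun {k} f x a => ?_,
    fun R x => Iff.rfl⟩
  · obtain ⟨y, hy⟩ := hne
    exact ⟨s ⟨y, hy⟩⟩
  · have hyU : y ∈ V_ θ := mem_of_tup_mem hU (hU.mem_trans hy (p .graph).2) (by simp)
    obtain ⟨a, ha⟩ := hsurj ⟨y, hyU⟩ hy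
    exact ⟨a, by rw [ha]⟩
  · rintro ⟨a, rfl⟩
    exact he a
  · refine (hF' k f (e ∘ x) (fun i => he (x i)) (e a) (he a)).trans ?_
    rw [← hinj.eq_iff]
    simp [I, e, Language.Structure.funMap]

variable {α : Type*}

/-- The formula expressing `InDomain`. The parameters are read off the variables `g`. -/
noncomputable def domF (g : Param L → α) (i : α) : setLang.Formula α :=
  tupMemF [g .index, g (.symbol none), i] (g .graph)

/-- The formula expressing `FnHolds`. -/
noncomputable def fnF (g : Param L → α) {k : ℕ} (f : L.Functions k) (i : α) (is : Fin k → α) :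
    setLang.Formula α :=
  tupMemF (g .index :: g (.symbol (some (.inl ⟨k, f⟩))) :: i :: List.ofFn is) (g .graph)

/-- The formula expressing `FnTotal`. -/
noncomputable def totalF {k : ℕ} (f : L.Functions k) : setLang.Formula (Param L) :=
  Language.Formula.iAlls (Fin k)
    ((Language.Formula.iInf fun i : Fin k => domF Sum.inl (.inr i)).imp
      (exF (domF (some ∘ Sum.inl) none ⊓ allF ((domF (some ∘ some ∘ Sum.inl) none).imp
        ((fnF (some ∘ some ∘ Sum.inl) f none (some ∘ some ∘ Sum.inr)).iff
          (eqF none (some none)))))))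

theorem realize_domF (hU : U.IsTransitive) {v : α → U} {g : Param L → α} {i : α} :
    (domF g i).Realize v ↔ InDomain (v ∘ g) (v i) := by
  rw [domF, realize_tupMemF hU]
  rfl

theorem realize_fnF (hU : U.IsTransitive) {v : α → U} {g : Param L → α} {k : ℕ}
    {f : L.Functions k} {i : α} {is : Fin k → α} :
    (fnF g f i is).Realize v ↔ FnHolds (v ∘ g) f (v i) (v ∘ is) := by
  rw [fnF, realize_tupMemF hU]
  simp [FnHolds, List.map_ofFn, Function.comp_def]

theorem realize_totalF (hU : U.IsTransitive) {p : Param L → U} {k : ℕ} {f : L.Functions k} :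
    (totalF f).Realize p ↔ FnTotal p f := by
  rw [totalF, Language.Formula.realize_iAlls]
  simp only [Language.Formula.realize_imp, Language.Formula.realize_iInf,
    realize_exF, Language.Formula.realize_inf, realize_allF, Language.Formula.realize_iff,
    realize_eqF, realize_domF hU, realize_fnF hU]
  rfl

theorem Codes.exists_inDomain {θ : Ordinal.{u}} {p : Param L → (V_ θ : ZFSet.{u})} {A : Type u}
    [L.Structure A] [Nonempty A] {e : A → (V_ θ : ZFSet.{u})} (h : Codes p A e) :
    ∃ y, InDomain p y :=
  ⟨e (Classical.arbitrary A), (h.dom _).2 ⟨_, rfl⟩⟩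

theorem Codes.fnTotal {θ : Ordinal.{u}} {p : Param L → (V_ θ : ZFSet.{u})} {A : Type u}
    [L.Structure A] {e : A → (V_ θ : ZFSet.{u})} (h : Codes p A e) {k : ℕ} (f : L.Functions k) :
    FnTotal p f := by
  have hdom : ∀ y, InDomain p y → ∃ a, e a = y := fun y hy => by
    obtain ⟨a, ha⟩ := (h.dom _).1 hy
    exact ⟨a, Subtype.ext ha⟩
  intro x hx
  choose x' hx' using fun i => hdom _ (hx i)
  obtain rfl : e ∘ x' = x := funext hx'
  refine ⟨e (Language.Structure.funMap f x'), (h.dom _).2 ⟨_, rfl⟩, fun z hz => ?_⟩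
  obtain ⟨a, rfl⟩ := hdom z hz
  rw [h.inj.eq_iff]
  exact h.fn f x' a

end Decoding

/-! ### Coding a family of structures in one set -/

section Coding

/-- A representation of the elements of a type by sets. -/
noncomputable def rep {A : Type u} (a : A) : ZFSet.{u} :=
  (Ordinal.typein WellOrderingRel a).toZFSet

theorem rep_injective {A : Type u} : Function.Injective (rep (A := A)) :=
  Ordinal.toZFSet_injective.comp (Ordinal.typein_injective _)

variable {L : FirstOrder.Language.{u, u}}

/-- The symbol `s` is true of the list `l`. A function symbol is read as its graph, with the value in
front, and `none` is read as the domain. -/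
def SymbolHolds (A : Type u) [L.Structure A] : Option L.Symbols → List A → Prop
  | none, l => ∃ a, l = [a]
  | some (.inl ⟨_, f⟩), l => ∃ x, l = Language.Structure.funMap f x :: List.ofFn x
  | some (.inr ⟨_, R⟩), l => ∃ x, Language.Structure.RelMap R x ∧ l = List.ofFn x

theorem exists_injective_lt_ord {X : Type u} {κ : Cardinal.{u}} (hX : #X ≤ κ) :
    ∃ r : X → Ordinal.{u}, Function.Injective r ∧ ∀ x, r x < κ.ord := by
  obtain ⟨R, hR, h⟩ := Cardinal.exists_ord_eq X
  exact ⟨Ordinal.typein R, Ordinal.typein_injective R, fun x =>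
    (Ordinal.typein_lt_type R x).trans_le (h ▸ ord_le_ord.2 hX)⟩

/-- A family of structures indexed by the ordinals below `o` is coded by a single set. -/
theorem exists_graph {o : Ordinal.{u}} (A : Set.Iio o → Type u) [∀ δ, L.Structure (A δ)]
    {c : Option L.Symbols → Ordinal.{u}} (hc : Function.Injective c) :
    ∃ W : ZFSet.{u}, ∀ (θ : Ordinal.{u}) (p : Param L → (V_ θ : ZFSet.{u})) (δ : Set.Iio o),
      (p .graph : ZFSet.{u}) = W → (p .index : ZFSet.{u}) = δ.1.toZFSet →
      (∀ s, (p (.symbol s) : ZFSet.{u}) = (c s).toZFSet) → ∃ e, Codes p (A δ) e := by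
  let W : ZFSet.{u} := ZFSet.range
    fun t : Σ δ : Set.Iio o, Σ s : Option L.Symbols, {l : List (A δ) // SymbolHolds (A δ) s l} =>
      tup (t.1.1.toZFSet :: (c t.2.1).toZFSet :: t.2.2.1.map rep)
  have hW : ∀ (δ : Set.Iio o) s l', tup (δ.1.toZFSet :: (c s).toZFSet :: l') ∈ W ↔
      ∃ l : List (A δ), SymbolHolds (A δ) s l ∧ l.map rep = l' := by
    intro δ s l'
    rw [ZFSet.mem_range]
    constructor
    · rintro ⟨⟨δ', s', l, hl⟩, h⟩
      have h := tup_injective h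
      simp only [List.cons.injEq, Ordinal.toZFSet_injective.eq_iff, hc.eq_iff] at h
      obtain ⟨hδ, rfl, rfl⟩ := h
      obtain rfl := Subtype.ext hδ
      exact ⟨l, hl, rfl⟩
    · rintro ⟨l, hl, rfl⟩
      exact ⟨⟨δ, s, l, hl⟩, rfl⟩
  refine ⟨W, fun θ p δ hpW hpδ hps => ?_⟩
  have hU := ZFSet.isTransitive_vonNeumann θ
  have hrep : ∀ a : A δ, rep a ∈ V_ θ := by
    intro a
    have h : tup (δ.1.toZFSet :: (c none).toZFSet :: [rep a]) ∈ W :=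
      (hW δ none _).2 ⟨[a], ⟨a, rfl⟩, rfl⟩
    exact mem_of_tup_mem hU (hU.mem_trans h (hpW ▸ (p .graph).2)) (by simp)
  have hmap : Function.Injective (List.map (rep (A := A δ))) :=
    List.map_injective_iff.2 rep_injective
  refine ⟨fun a => ⟨rep a, hrep a⟩, fun a b h => rep_injective (congrArg Subtype.val h),
    fun y => ?_, fun f x a => ?_, fun R x => ?_⟩
  · rw [hpW, hpδ, hps, hW]
    constructor
    · rintro ⟨_, ⟨a, rfl⟩, h⟩
      exact ⟨a, by simpa using h⟩
    · rintro ⟨a, rfl⟩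
      exact ⟨[a], ⟨a, rfl⟩, rfl⟩
  · have : (rep a :: List.ofFn fun i => rep (x i)) = (a :: List.ofFn x).map rep := by
      simp [List.map_ofFn, Function.comp_def]
    rw [hpW, hpδ, hps, hW, this]
    simp only [hmap.eq_iff]
    constructor
    · rintro ⟨_, ⟨x', rfl⟩, h⟩
      obtain ⟨rfl, h'⟩ := List.cons.inj h
      rw [List.ofFn_injective h']
    · rintro rfl
      exact ⟨_, ⟨x, rfl⟩, rfl⟩
  · have : (List.ofFn fun i => rep (x i)) = (List.ofFn x).map rep := by
      simp [List.map_ofFn, Function.comp_def]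
    rw [hpW, hpδ, hps, hW, this]
    simp only [hmap.eq_iff]
    constructor
    · rintro ⟨_, ⟨x', hx', rfl⟩, h⟩
      rwa [← List.ofFn_injective h]
    · intro h
      exact ⟨_, ⟨x, h, rfl⟩, rfl⟩

end Coding

/-! ### Sub-extendibility implies weak compactness -/

/-- The downward Löwenheim–Skolem theorem for `V_θ`, with the submodel given as a set. -/
theorem exists_elementarySubmodel {κ : Cardinal.{u}} (hκ : ℵ₀ ≤ κ) {θ : Ordinal.{u}}
    (hθ : κ.ord < θ) {W : ZFSet.{u}} (hW : W ∈ V_ θ) :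
    ∃ M : ZFSet.{u}, IsElementarySubmodel M (V_ θ) ∧ (κ.ord + 1).toZFSet ⊆ M ∧ W ∈ M ∧
      M.card = κ := by
  have hsub : insert W (κ.ord + 1).toZFSet ⊆ V_ θ := by
    intro x hx
    rcases ZFSet.mem_insert_iff.1 hx with rfl | hx
    · exact hW
    · obtain ⟨a, ha, rfl⟩ := Ordinal.mem_toZFSet_iff.1 hx
      rw [ZFSet.mem_vonNeumann, Ordinal.rank_toZFSet]
      exact (Order.lt_add_one_iff.1 ha).trans_lt hθ
  have hcard : (κ.ord + 1).toZFSet.card = κ := by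
    rw [Ordinal.card_toZFSet, Ordinal.card_add_one, card_ord, add_one_eq hκ]
  have hlang : setLang.card ≤ ℵ₀ := by
    have : Countable setLang.Symbols := by
      have : Countable (Σ n, setLang.Relations n) := by
        refine Function.Injective.countable (f := Sigma.fst) ?_
        rintro ⟨_, ⟨⟩⟩ ⟨_, ⟨⟩⟩ _
        rfl
      have : IsEmpty (Σ n, setLang.Functions n) := ⟨fun f => Empty.elim f.2⟩
      unfold Language.Symbols
      infer_instance
    exact mk_le_aleph0
  obtain ⟨S, hS, hSκ⟩ := Language.exists_elementarySubstructure_card_eq setLang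
    {x : (V_ θ : ZFSet.{u}) | (x : ZFSet.{u}) ∈ insert W (κ.ord + 1).toZFSet} κ hκ
    (by
      rw [lift_id'.{u, u + 1}]
      refine (mk_le_of_injective (β := (insert W (κ.ord + 1).toZFSet : ZFSet.{u}))
        (f := fun x => ⟨x.1.1, x.2⟩) fun a b h => ?_).trans ?_
      · exact Subtype.ext (Subtype.ext (Subtype.mk.inj h))
      · rw [ZFSet.cardinalMk_coe_sort, lift_le]
        refine ZFSet.card_insert_le.trans ?_
        rw [hcard, add_one_eq hκ])
    ((lift_le_aleph0.2 hlang).trans (aleph0_le_lift.2 hκ))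
    (by
      rw [lift_id'.{u, u + 1}, ZFSet.cardinalMk_coe_sort, lift_le]
      refine le_trans ?_ (Ordinal.card_le_card_vonNeumann θ)
      rw [← card_ord κ]
      exact Ordinal.card_le_card hθ.le)
  let M : ZFSet.{u} := ZFSet.range fun x : S => ((x : (V_ θ : ZFSet.{u})) : ZFSet.{u})
  have hM : ∀ {x : ZFSet.{u}}, x ∈ M ↔ ∃ h : x ∈ V_ θ, (⟨x, h⟩ : (V_ θ : ZFSet.{u})) ∈ S := by
    intro x
    rw [ZFSet.mem_range]
    constructor
    · rintro ⟨⟨y, hy⟩, rfl⟩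
      exact ⟨y.2, hy⟩
    · rintro ⟨h, h'⟩
      exact ⟨⟨_, h'⟩, rfl⟩
  let ε : M ≃ S :=
    { toFun := fun x => ⟨⟨x, (hM.1 x.2).1⟩, (hM.1 x.2).2⟩
      invFun := fun x => ⟨x.1.1, hM.2 ⟨x.1.2, x.2⟩⟩
      left_inv := fun _ => rfl
      right_inv := fun _ => rfl }
  let E : M ≃[setLang] S :=
    { toEquiv := ε
      map_fun' := fun f => Empty.elim f
      map_rel' := fun {n} r x => by cases r; exact Iff.rfl }
  refine ⟨M, ⟨S.subtype.comp E.toElementaryEmbedding, fun x => rfl⟩, fun x hx => ?_, ?_, ?_⟩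
  · have hx' := ZFSet.mem_insert_of_mem W hx
    exact hM.2 ⟨hsub hx', hS hx'⟩
  · exact hM.2 ⟨hW, hS (ZFSet.mem_insert _ _)⟩
  · have := mk_congr ε
    rw [ZFSet.cardinalMk_coe_sort] at this
    rw [lift_id'.{u, u + 1}, ← this, lift_inj] at hSκ
    exact hSκ

section Transfer

theorem mem_iff_of_elementary {M N : ZFSet.{u}} (j : M ↪ₑ[setLang] N) (x y : M) :
    (j x : ZFSet.{u}) ∈ (j y : ZFSet.{u}) ↔ (x : ZFSet.{u}) ∈ (y : ZFSet.{u}) := by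
  have := j.map_formula (memF true false) fun b => if b then x else y
  rw [realize_memF, realize_memF] at this
  exact this

/-- The formula expressing that every nonempty element of `v` has a largest element with respect to
membership. -/
noncomputable def maxF : setLang.Formula Unit :=
  allF ((memF none (some ())).imp ((exF (memF none (some none))).imp
    (exF (memF none (some none) ⊓
      allF ((memF none (some (some none))).imp (eqF none (some none) ⊔ memF none (some none)))))))

theorem realize_maxF {U : ZFSet.{u}} (hU : U.IsTransitive) {v : Unit → U} :
    maxF.Realize v ↔ ∀ x ∈ (v () : ZFSet.{u}), x ≠ ∅ → ∃ y ∈ x, ∀ z ∈ x, z = y ∨ z ∈ y := by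
  simp only [maxF, realize_allF, realize_exF, Language.Formula.realize_imp,
    Language.Formula.realize_inf, Language.Formula.realize_sup, realize_memF, realize_eqF,
    Option.elim_none, Option.elim_some]
  constructor
  · intro h x hx hne
    have hxU := hU.mem_trans hx (v ()).2
    have hU' : ∀ y ∈ x, y ∈ U := fun y hy => hU.mem_trans hy hxU
    obtain ⟨y, hy⟩ : ∃ y, y ∈ x := by
      by_contra! h'
      exact hne ((ZFSet.eq_empty x).2 h')
    obtain ⟨y, hy, h⟩ := h ⟨x, hxU⟩ hx ⟨⟨y, hU' y hy⟩, hy⟩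
    exact ⟨y, hy, fun z hz => by simpa [Subtype.ext_iff] using h ⟨z, hU' z hz⟩ hz⟩
  · rintro h x hx ⟨y, hy⟩
    obtain ⟨z, hz, h⟩ := h x hx (by rintro h; rw [h] at hy; exact ZFSet.notMem_empty _ hy)
    have hxU := hU.mem_trans hx (v ()).2
    exact ⟨⟨z, hU.mem_trans hz hxU⟩, hz, fun w hw => by simpa [Subtype.ext_iff] using h w hw⟩

variable {L : FirstOrder.Language.{u, u}}

/-- Change the index, that is, the member of the family of structures that is being described. -/
def Param.withIndex {X : Type*} (p : Param L → X) (d : X) : Param L → X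
  | .graph => p .graph
  | .index => d
  | .symbol s => p (.symbol s)

/-- The formula expressing that `ψ` holds of all structures of the family with indices above `none`
and below the given bound. The bound occupies the place of the index. -/
noncomputable def forallIndexF (ψ : setLang.Formula (Param L)) :
    setLang.Formula (Option (Param L)) :=
  allF ((memF none (some (some .index))).imp ((memF (some none) none).imp
    (ψ.relabel (Param.withIndex (some ∘ some) none))))

theorem realize_forallIndexF {U : ZFSet.{u}} {ψ : setLang.Formula (Param L)}
    {v : Option (Param L) → U} :
    (forallIndexF ψ).Realize v ↔ ∀ d : U, (d : ZFSet.{u}) ∈ (v (some .index) : ZFSet.{u}) →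
      (v none : ZFSet.{u}) ∈ (d : ZFSet.{u}) → ψ.Realize (Param.withIndex (v ∘ some) d) := by
  simp only [forallIndexF, realize_allF, Language.Formula.realize_imp, realize_memF,
    Language.Formula.realize_relabel, Option.elim_none, Option.elim_some]
  refine forall_congr' fun d => imp_congr_right fun _ => imp_congr_right fun _ =>
    iff_of_eq (congrArg _ ?_)
  ext (_ | _ | _) <;> rfl

end Transfer

theorem add_one_lt_ord {κ : Cardinal.{u}} (hκ : ℵ₀ ≤ κ) {a : Ordinal.{u}} (ha : a < κ.ord) :
    a + 1 < κ.ord :=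
  (isSuccLimit_ord hκ).succ_lt ha

theorem toZFSet_mem_of_le {M : ZFSet.{u}} {o a : Ordinal.{u}} (hM : (o + 1).toZFSet ⊆ M) (ha : a ≤ o) :
    a.toZFSet ∈ M :=
  hM (Ordinal.toZFSet_mem_toZFSet_iff.2 (Order.lt_add_one_iff.2 ha))

/-- The supremum of `j '' κ` is an upper bound, strictly since `κ` is a limit ordinal. -/
theorem mem_supImage {M N : ZFSet.{u}} (j : M ↪ₑ[setLang] N) {κ : Cardinal.{u}} (hκ : ℵ₀ ≤ κ)
    (hM : (κ.ord + 1).toZFSet ⊆ M) (x : M) (hx : (x : ZFSet.{u}) ∈ κ.ord.toZFSet) :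
    (j x : ZFSet.{u}) ∈ supImage j κ.ord := by
  obtain ⟨a, ha, hax⟩ := Ordinal.mem_toZFSet_iff.1 hx
  have ha' := add_one_lt_ord hκ ha
  rw [supImage, ZFSet.mem_iUnion]
  refine ⟨⟨⟨(a + 1).toZFSet, toZFSet_mem_of_le hM ha'.le⟩,
    Ordinal.toZFSet_mem_toZFSet_iff.2 ha'⟩, ?_⟩
  rw [mem_iff_of_elementary]
  exact hax ▸ Ordinal.toZFSet_mem_toZFSet_iff.2 (lt_add_one a)

/-- `ℵ₀` is not weakly sub-extendible, because every nonzero `n ∈ ω` has a largest element, while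
`sup (j '' ω)` has none. -/
theorem WeaklySubExtendible.aleph0_lt {κ : Cardinal.{u}} (hκ : ℵ₀ ≤ κ)
    (h : WeaklySubExtendible κ) : ℵ₀ < κ := by
  refine lt_of_le_of_ne hκ ?_
  rintro rfl
  have hθ : (ℵ₀ : Cardinal.{u}).ord < (ℵ₀ : Cardinal.{u}).ord + 1 := lt_add_one _
  obtain ⟨M, hMV, hM, -, hcard⟩ := exists_elementarySubmodel hκ hθ
    (W := (ℵ₀ : Cardinal.{u}).ord.toZFSet) (by rwa [ZFSet.mem_vonNeumann, Ordinal.rank_toZFSet])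
  obtain ⟨θ', j, -, k, hk, hsup⟩ := h _ hθ M hMV hM hcard
  obtain ⟨e, he⟩ := hMV
  have hmax : maxF.Realize fun _ : Unit => e k := by
    rw [realize_maxF (ZFSet.isTransitive_vonNeumann _), he, hk]
    intro x hx hne
    obtain ⟨a, ha, rfl⟩ := Ordinal.mem_toZFSet_iff.1 hx
    rw [ord_aleph0] at ha
    obtain ⟨n, rfl⟩ := Ordinal.lt_omega0.1 ha
    cases n with
    | zero => simp at hne
    | succ n =>
      refine ⟨(n : Ordinal.{u}).toZFSet, by simp, fun z hz => ?_⟩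
      simpa using hz
  have hmax' := (j.map_formula maxF fun _ : Unit => k).2
    ((e.map_formula maxF fun _ : Unit => k).1 hmax)
  rw [realize_maxF (ZFSet.isTransitive_vonNeumann _)] at hmax'
  have hmem := mem_supImage j hκ hM
  have hlt : ∀ n < (ℵ₀ : Cardinal.{u}).ord, n.toZFSet ∈ (ℵ₀ : Cardinal.{u}).ord.toZFSet :=
    fun n hn => Ordinal.toZFSet_mem_toZFSet_iff.2 hn
  have h0 : (0 : Ordinal.{u}) < (ℵ₀ : Cardinal.{u}).ord := by simp
  obtain ⟨y, hy, hy'⟩ := hmax' _ hsup fun h0' => by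
    have := hmem ⟨_, toZFSet_mem_of_le hM h0.le⟩ (hlt _ h0)
    rw [h0'] at this
    exact ZFSet.notMem_empty _ this
  obtain ⟨⟨x, hx⟩, hyx⟩ := ZFSet.mem_iUnion.1 hy
  rcases hy' _ (hmem x hx) with h' | h'
  · exact ZFSet.mem_irrefl _ (h' ▸ hyx)
  · exact ZFSet.mem_asymm h' hyx

/-- A statement that holds for all sufficiently large indices below `κ` holds for the index
`sup (j '' κ)` on the other side of the embedding. -/
theorem realize_supImage {κ : Cardinal.{u}} (hκ : ℵ₀ ≤ κ) {L : FirstOrder.Language.{u, u}}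
    {M : ZFSet.{u}} {θ θ' : Ordinal.{u}} (hM : (κ.ord + 1).toZFSet ⊆ M)
    (e : M ↪ₑ[setLang] (V_ θ : ZFSet.{u})) (he : ∀ x : M, (e x : ZFSet.{u}) = x)
    (j : M ↪ₑ[setLang] (V_ θ' : ZFSet.{u})) (p : Param L → M)
    (hp : (p .index : ZFSet.{u}) = κ.ord.toZFSet) {d : (V_ θ' : ZFSet.{u})}
    (hd : (d : ZFSet.{u}) = supImage j κ.ord)
    (hdj : (d : ZFSet.{u}) ∈ (j (p .index) : ZFSet.{u})) {a : Ordinal.{u}} (ha : a < κ.ord)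
    (ψ : setLang.Formula (Param L))
    (h : ∀ (δ : Ordinal.{u}) (x : (V_ θ : ZFSet.{u})), δ < κ.ord → a < δ →
      (x : ZFSet.{u}) = δ.toZFSet → ψ.Realize (Param.withIndex (e ∘ p) x)) :
    ψ.Realize (Param.withIndex (j ∘ p) d) := by
  let m : M := ⟨a.toZFSet, toZFSet_mem_of_le hM ha.le⟩
  let v : Option (Param L) → M := fun o => o.elim m p
  have h₁ : (forallIndexF ψ).Realize (e ∘ v) := by
    rw [realize_forallIndexF]
    intro x hx hax
    simp only [v, Function.comp_apply, Option.elim_some, Option.elim_none, he, hp, m] at hx hax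
    obtain ⟨δ, hδ, hδx⟩ := Ordinal.mem_toZFSet_iff.1 hx
    rw [← hδx, Ordinal.toZFSet_mem_toZFSet_iff] at hax
    exact h δ x hδ hax hδx.symm
  have h₂ := (j.map_formula _ v).2 ((e.map_formula _ v).1 h₁)
  rw [realize_forallIndexF] at h₂
  refine h₂ d hdj ?_
  rw [hd]
  exact mem_supImage j hκ hM m (Ordinal.toZFSet_mem_toZFSet_iff.2 ha)

/-- Models of the initial segments of the theory, coded in one set `W ∈ M`, are carried by `j` to a
family of structures in `V_θ'`. Its member with index `sup (j '' κ)` satisfies the whole theory. -/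
theorem WeaklySubExtendible.mem_WCS {κ : Cardinal.{u}} (hκ : ℵ₀ ≤ κ)
    (h : WeaklySubExtendible κ) : κ ∈ WCS.{u} := by
  refine ⟨h.aleph0_lt hκ, fun L hL T hT => ?_⟩
  -- Number the sentences of `T` by ordinals below `κ`, and let `A δ` be a model of all sentences
  -- with numbers below `δ`.
  obtain ⟨r, hrinj, hr⟩ := exists_injective_lt_ord
    ((mk_set_le T).trans (mk_msoFormula_le hκ hL 0 0))
  have hsat : ∀ δ : Set.Iio κ.ord, Satisfiable {φ | ∃ h : φ ∈ T, r ⟨φ, h⟩ < δ} := by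
    intro δ
    refine hT _ (fun φ hφ => hφ.1) ?_
    refine lt_of_le_of_lt ?_ (lt_ord.1 δ.2)
    rw [← lift_le.{u + 1}, ← Cardinal.mk_Iio_ordinal]
    rw [← lift_id'.{u, u + 1} #(Set.Iio (δ : Ordinal.{u}))]
    refine lift_mk_le_lift_mk_of_injective (f := fun φ => ⟨r ⟨φ.1, φ.2.1⟩, φ.2.2⟩) fun φ ψ h =>
      Subtype.ext (Subtype.mk.inj (hrinj (Subtype.mk.inj h)))
  choose A hA I hAT using hsat
  obtain ⟨c, hc, hcκ⟩ := exists_injective_lt_ord (X := Option L.Symbols) (κ := κ)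
    (by rw [mk_option]; exact add_le_of_le hκ hL (one_le_aleph0.trans hκ))
  obtain ⟨W, hW⟩ := exists_graph A hc
  let θ : Ordinal.{u} := max W.rank κ.ord + 1
  have hθ : κ.ord < θ := Order.lt_add_one_iff.2 (le_max_right _ _)
  obtain ⟨M, hMV, hM, hWM, hcard⟩ := exists_elementarySubmodel hκ hθ (W := W)
    (ZFSet.mem_vonNeumann.2 (Order.lt_add_one_iff.2 (le_max_left _ _)))
  obtain ⟨θ', j, -, k, hk, hsup⟩ := h θ hθ M hMV hM hcard
  obtain ⟨e, he⟩ := hMV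
  let p : Param L → M
    | .graph => ⟨W, hWM⟩
    | .index => k
    | .symbol s => ⟨(c s).toZFSet, toZFSet_mem_of_le hM (hcκ s).le⟩
  let d : (V_ θ' : ZFSet.{u}) :=
    ⟨supImage j κ.ord, (ZFSet.isTransitive_vonNeumann θ').mem_trans hsup (j k).2⟩
  have transfer := fun {a : Ordinal.{u}} (ha : a < κ.ord) (ψ : setLang.Formula (Param L)) =>
    realize_supImage hκ hM e he j p hk (d := d) rfl hsup ha ψ
  have hcodes : ∀ (δ : Ordinal.{u}) (x : (V_ θ : ZFSet.{u})) (hδ : δ < κ.ord),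
      (x : ZFSet.{u}) = δ.toZFSet → ∃ e', Codes (Param.withIndex (e ∘ p) x) (A ⟨δ, hδ⟩) e' := by
    intro δ x hδ hx
    exact hW θ _ ⟨δ, hδ⟩ (he _) hx fun s => he _
  have h0 : (0 : Ordinal.{u}) < κ.ord := by
    exact ord_pos.2 (aleph0_pos.trans_le hκ)
  have hU := fun θ : Ordinal.{u} => ZFSet.isTransitive_vonNeumann θ
  obtain ⟨B, hB, J, e', hcB⟩ := exists_codes (Param.withIndex (j ∘ p) d)
    (by
      have := transfer h0 (exF (domF some none)) fun δ x hδ _ hx => by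
        obtain ⟨e', h⟩ := hcodes δ x hδ hx
        rw [realize_exF]
        simp only [realize_domF (hU _)]
        exact h.exists_inDomain
      rw [realize_exF] at this
      simp only [realize_domF (hU _)] at this
      exact this)
    (fun k f => (realize_totalF (hU _)).1 <| transfer h0 (totalF f) fun δ x hδ _ hx => by
      obtain ⟨e', h⟩ := hcodes δ x hδ hx
      exact (realize_totalF (hU _)).2 (h.fnTotal f))
  refine ⟨B, hB, J, fun φ hφ => ?_⟩
  obtain ⟨ψ, hψ⟩ := MSOFormula.expressible φ
  have key : ∀ (θ : Ordinal.{u}) (q : Param L → (V_ θ : ZFSet.{u})) (A : Type u) (I : L.Structure A)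
      (e : A → (V_ θ : ZFSet.{u})), Codes q A e →
      ((ψ.relabel (Sum.elim id (Sum.elim Fin.elim0 Fin.elim0))).Realize q ↔
        MSOSentence.Holds φ A) := by
    intro θ q A I e hc
    rw [Language.Formula.realize_relabel]
    refine Iff.trans (iff_of_eq (congrArg _ ?_))
      (hψ θ q A I e hc Fin.elim0 Fin.elim0 Fin.elim0 fun b => b.elim0)
    ext (_ | b | b)
    · rfl
    · exact b.elim0
    · exact b.elim0
  refine (key θ' _ B J e' hcB).1 (transfer (hr ⟨φ, hφ⟩) _ fun δ x hδ hφδ hx => ?_)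
  obtain ⟨e', hc'⟩ := hcodes δ x hδ hx
  exact (key θ _ _ _ e' hc').2 (hAT ⟨δ, hδ⟩ φ ⟨hφ, hφδ⟩)

/-! ### Monadic second-order characterization of the ranks `V_θ` -/

section RankLike

variable {A : Type u}

/-- A monadic second-order property of a binary relation which characterizes the relations that are
isomorphic to the membership relation of some `V_θ`. The set in the last condition is the set of
all ranks `V_β` that belong to `V_θ`. -/
structure RankLike (E : A → A → Prop) : Prop where
  wf : ∀ B : Set A, (∃ x, x ∈ B) → ∃ x, x ∈ B ∧ ∀ y, E y x → y ∉ B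
  ext : ∀ a b, (∀ z, E z a ↔ E z b) → a = b
  sub : ∀ a, ∀ B : Set A, (∀ z, z ∈ B → E z a) → ∃ b, ∀ z, E z b ↔ z ∈ B
  levels : ∃ X : Set A,
    (∀ x, x ∈ X → ∀ y, E y x ↔ ∃ c, c ∈ X ∧ E c x ∧ ∀ z, E z y → E z c) ∧
      ∀ a, ∃ x, x ∈ X ∧ ∀ z, E z a → E z x

theorem rankLike_of_equiv {θ : Ordinal.{u}} {E : A → A → Prop} (f : A ≃ (V_ θ : ZFSet.{u}))
    (hf : ∀ a b, E a b ↔ (f a : ZFSet.{u}) ∈ (f b : ZFSet.{u})) : RankLike E := by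
  have hU := ZFSet.isTransitive_vonNeumann θ
  have hget : ∀ {x : ZFSet.{u}} (b : A), x ∈ (f b : ZFSet.{u}) → ∃ a, (f a : ZFSet.{u}) = x :=
    fun b hx => ⟨f.symm ⟨_, hU.mem_trans hx (f b).2⟩, by simp⟩
  have hsub : ∀ a b, (∀ z, E z a → E z b) ↔ (f a : ZFSet.{u}) ⊆ (f b : ZFSet.{u}) := by
    intro a b
    simp only [hf]
    refine ⟨fun h x hx => ?_, fun h z hz => h hz⟩
    obtain ⟨z, rfl⟩ := hget a hx
    exact h z hx
  refine ⟨fun B ⟨x, hx⟩ => ?_, fun a b h => ?_, fun a B h => ?_,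
    {x | ∃ β, (f x : ZFSet.{u}) = V_ β}, ?_, fun a => ?_⟩
  · have hwf : WellFounded E :=
      Subrelation.wf (fun {a b} h => (hf a b).1 h)
        (InvImage.wf (fun a => (f a : ZFSet.{u})) ZFSet.mem_wf)
    obtain ⟨m, hm, hm'⟩ := hwf.has_min B ⟨x, hx⟩
    exact ⟨m, hm, fun y hy hyB => hm' y hyB hy⟩
  · refine f.injective (Subtype.ext (subset_antisymm ?_ ?_))
    · exact (hsub a b).1 fun z => (h z).1
    · exact (hsub b a).1 fun z => (h z).2
  · let y : ZFSet.{u} := ZFSet.range fun z : B => (f z : ZFSet.{u})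
    have hy : y ⊆ f a := by
      intro x hx
      obtain ⟨z, rfl⟩ := ZFSet.mem_range.1 hx
      exact (hf _ _).1 (h z z.2)
    refine ⟨f.symm ⟨y, ZFSet.mem_vonNeumann_of_subset hy (f a).2⟩, fun z => ?_⟩
    rw [hf, Equiv.apply_symm_apply, ZFSet.mem_range]
    constructor
    · rintro ⟨z', h⟩
      rw [← f.injective (Subtype.ext h)]
      exact z'.2
    · exact fun hz => ⟨⟨z, hz⟩, rfl⟩
  · rintro x ⟨β, hβ⟩ y
    simp only [hsub]
    simp only [hf, hβ]
    constructor
    · intro hy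
      obtain ⟨γ, hγ, hyγ⟩ := ZFSet.mem_vonNeumann'.1 hy
      have hγβ := ZFSet.vonNeumann_mem_of_lt hγ
      obtain ⟨c, hc⟩ := hget x (hβ ▸ hγβ)
      exact ⟨c, ⟨γ, hc⟩, hc ▸ hγβ, hc ▸ hyγ⟩
    · rintro ⟨c, -, hc, hy⟩
      exact ZFSet.mem_vonNeumann_of_subset hy hc
  · obtain ⟨γ, hγ, h⟩ := ZFSet.mem_vonNeumann'.1 (f a).2
    refine ⟨f.symm ⟨_, ZFSet.vonNeumann_mem_of_lt hγ⟩, ⟨γ, by simp⟩, ?_⟩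
    rw [hsub]
    simpa using h

/-- The Mostowski collapse of a relation as in `RankLike` is some `V_θ`. -/
theorem RankLike.exists_equiv {E : A → A → Prop} (h : RankLike E) :
    ∃ (θ : Ordinal.{u}) (f : A ≃ (V_ θ : ZFSet.{u})),
      ∀ a b, E a b ↔ (f a : ZFSet.{u}) ∈ (f b : ZFSet.{u}) := by
  have hwf : WellFounded E := by
    rw [WellFounded.wellFounded_iff_has_min]
    intro B hB
    obtain ⟨x, hx, hx'⟩ := h.wf B hB
    exact ⟨x, hx, fun y hy hyx => hx' y hyx hy⟩
  let π : A → ZFSet.{u} := hwf.fix fun a ih => ZFSet.range fun z : {z // E z a} => ih z.1 z.2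
  have hπ : ∀ a, π a = ZFSet.range fun z : {z // E z a} => π z.1 := fun a => hwf.fix_eq _ a
  have hmem : ∀ {a w}, w ∈ π a ↔ ∃ z, E z a ∧ π z = w := by
    intro a w
    rw [hπ, ZFSet.mem_range]
    simp
  have hinj : Function.Injective π := by
    intro a
    induction a using hwf.induction with
    | _ a ih =>
      intro b hab
      refine h.ext a b fun z => ⟨fun hz => ?_, fun hz => ?_⟩
      · obtain ⟨y, hy, hyz⟩ := hmem.1 (hab ▸ hmem.2 ⟨z, hz, rfl⟩ : π z ∈ π b)
        rwa [ih z hz hyz.symm]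
      · obtain ⟨y, hy, hyz⟩ := hmem.1 (hab ▸ hmem.2 ⟨z, hz, rfl⟩ : π z ∈ π a)
        rwa [← ih y hy hyz]
  have hE : ∀ a b, E a b ↔ π a ∈ π b := fun a b => by
    rw [hmem]
    refine ⟨fun hab => ⟨a, hab, rfl⟩, ?_⟩
    rintro ⟨z, hz, hza⟩
    rwa [← hinj hza]
  have hsub : ∀ a w, w ⊆ π a → ∃ b, π b = w := by
    intro a w hw
    obtain ⟨b, hb⟩ := h.sub a {z | π z ∈ w} fun z hz => (hE z a).2 (hw hz)
    refine ⟨b, ZFSet.ext fun x => ?_⟩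
    rw [hmem]
    constructor
    · rintro ⟨z, hz, rfl⟩
      exact (hb z).1 hz
    · intro hx
      obtain ⟨z, -, rfl⟩ := hmem.1 (hw hx)
      exact ⟨z, (hb z).2 hx, rfl⟩
  obtain ⟨X, hX, hX'⟩ := h.levels
  have hsubset : ∀ a b, (∀ z, E z a → E z b) ↔ π a ⊆ π b := by
    intro a b
    refine ⟨fun h w hw => ?_, fun h z hz => (hE _ _).2 (h ((hE _ _).1 hz))⟩
    obtain ⟨z, hz, rfl⟩ := hmem.1 hw
    exact (hE _ _).1 (h z hz)
  have hrank : ∀ x, x ∈ X → π x = V_ (π x).rank := by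
    intro x
    induction x using hwf.induction with
    | _ x ih =>
      intro hx
      refine subset_antisymm (ZFSet.subset_vonNeumann_self _) fun w hw => ?_
      obtain ⟨y, hy, hwy⟩ := ZFSet.lt_rank_iff.1 (ZFSet.mem_vonNeumann.1 hw)
      obtain ⟨y, hyx, rfl⟩ := hmem.1 hy
      obtain ⟨c, hc, hcx, hyc⟩ := (hX x hx y).1 hyx
      have hwc : w ⊆ π c := by
        rw [ih c hcx hc, ZFSet.subset_vonNeumann]
        exact hwy.trans (ZFSet.rank_mono ((hsubset y c).1 hyc))
      obtain ⟨b, rfl⟩ := hsub c w hwc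
      exact (hE b x).1 ((hX x hx b).2 ⟨c, hc, hcx, (hsubset b c).2 hwc⟩)
  let N : ZFSet.{u} := ZFSet.range π
  have hN : ∀ w, w ∈ V_ N.rank ↔ ∃ a, π a = w := by
    intro w
    rw [ZFSet.mem_vonNeumann]
    constructor
    · intro hw
      obtain ⟨y, hy, hwy⟩ := ZFSet.lt_rank_iff.1 hw
      obtain ⟨a, rfl⟩ := ZFSet.mem_range.1 hy
      obtain ⟨x, hx, hax⟩ := hX' a
      refine hsub x w ?_
      rw [hrank x hx, ZFSet.subset_vonNeumann]
      exact hwy.trans (ZFSet.rank_mono ((hsubset a x).1 hax))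
    · rintro ⟨a, rfl⟩
      exact ZFSet.rank_lt_of_mem (ZFSet.mem_range_self a)
  refine ⟨N.rank, Equiv.ofBijective (fun a => ⟨π a, (hN _).2 ⟨a, rfl⟩⟩) ⟨fun a b hab => ?_, ?_⟩, hE⟩
  · exact hinj (congrArg Subtype.val hab)
  · rintro ⟨w, hw⟩
    obtain ⟨a, rfl⟩ := (hN w).1 hw
    exact ⟨a, rfl⟩

end RankLike

section Sentences

/-- Function symbols of the language of set theory with constants `C`. -/
inductive ConstFn (C : Type u) : ℕ → Type u
  | const (c : C) : ConstFn C 0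

/-- Relation symbols of the language of set theory with constants, in the universe `u`. -/
inductive ConstRel : ℕ → Type u
  | mem : ConstRel 2

/-- The language of set theory with constants `C`. -/
def constLang (C : Type u) : FirstOrder.Language.{u, u} := ⟨ConstFn C, ConstRel⟩

variable {C : Type u}

theorem card_constLang_le {κ : Cardinal.{u}} (hκ : ℵ₀ ≤ κ) (hC : #C ≤ κ) :
    (constLang C).card ≤ κ := by
  let f : Option C → (constLang C).Symbols := fun o =>
    o.elim (.inr ⟨2, ConstRel.mem⟩) fun c => .inl ⟨0, ConstFn.const c⟩
  have hf : Function.Surjective f := by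
    rintro (⟨_, ⟨c⟩⟩ | ⟨_, ⟨⟩⟩)
    exacts [⟨some c, rfl⟩, ⟨none, rfl⟩]
  refine (mk_le_of_surjective hf).trans ?_
  rw [mk_option]
  exact add_le_of_le hκ hC (one_le_aleph0.trans hκ)

variable {A : Type u} [I : (constLang C).Structure A] {n m : ℕ}

/-- The interpretation of the membership symbol. -/
def memInterp (C : Type u) [I : (constLang C).Structure A] (a b : A) : Prop :=
  I.RelMap (n := 2) ConstRel.mem ![a, b]

/-- The interpretation of a constant. -/
def constInterp (A : Type u) [I : (constLang C).Structure A] (c : C) : A :=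
  I.funMap (n := 0) (ConstFn.const c) Fin.elim0

/-- The term consisting of a constant. -/
def constT (c : C) : (constLang C).Term (Fin n) :=
  .func (l := 0) (ConstFn.const c) Fin.elim0

@[simp] theorem realize_constT (c : C) (v : Fin n → A) : (constT c).realize v = constInterp A c :=
  congrArg (I.funMap (n := 0) (ConstFn.const c)) (Subsingleton.elim _ _)

namespace MSOFormula

variable {v : Fin n → A} {V : Fin m → Set A}

/-- The atomic formula `s ∈ t`. -/
def memT (s t : (constLang C).Term (Fin n)) : MSOFormula (constLang C) n m :=
  .rel (k := 2) ConstRel.mem ![s, t]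

@[simp] theorem realize_memT {s t : (constLang C).Term (Fin n)} :
    (memT s t : MSOFormula (constLang C) n m).Realize v V ↔ memInterp C (s.realize v) (t.realize v) := by
  refine iff_of_eq (congrArg (I.RelMap (n := 2) ConstRel.mem) (funext fun i => ?_))
  fin_cases i <;> rfl

variable {L : FirstOrder.Language.{u, u}}

/-- Negation. -/
def not (φ : MSOFormula L n m) : MSOFormula L n m := φ.imp .falsum

/-- Conjunction. -/
def and (φ ψ : MSOFormula L n m) : MSOFormula L n m := (φ.imp ψ.not).not

/-- Equivalence. -/
def iff (φ ψ : MSOFormula L n m) : MSOFormula L n m := (φ.imp ψ).and (ψ.imp φ)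

/-- First-order existential quantification. -/
def ex (φ : MSOFormula L (n + 1) m) : MSOFormula L n m := φ.not.all.not

/-- Second-order existential quantification. -/
def exSet (φ : MSOFormula L n (m + 1)) : MSOFormula L n m := φ.not.allSet.not

section Realize

variable {A : Type u} [L.Structure A] {v : Fin n → A} {V : Fin m → Set A}

@[simp] theorem realize_imp {φ ψ : MSOFormula L n m} :
    (φ.imp ψ).Realize v V ↔ (φ.Realize v V → ψ.Realize v V) := Iff.rfl

@[simp] theorem realize_not {φ : MSOFormula L n m} : φ.not.Realize v V ↔ ¬ φ.Realize v V := Iff.rfl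

@[simp] theorem realize_and {φ ψ : MSOFormula L n m} :
    (φ.and ψ).Realize v V ↔ φ.Realize v V ∧ ψ.Realize v V := by
  simp [and]

@[simp] theorem realize_iff {φ ψ : MSOFormula L n m} :
    (φ.iff ψ).Realize v V ↔ (φ.Realize v V ↔ ψ.Realize v V) := by
  simp [iff, iff_iff_implies_and_implies]

@[simp] theorem realize_all {φ : MSOFormula L (n + 1) m} :
    φ.all.Realize v V ↔ ∀ a : A, φ.Realize (Fin.snoc (α := fun _ => A) v a) V := Iff.rfl

@[simp] theorem realize_allSet {φ : MSOFormula L n (m + 1)} :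
    φ.allSet.Realize v V ↔ ∀ B : Set A, φ.Realize v (Fin.snoc (α := fun _ => Set A) V B) := Iff.rfl

@[simp] theorem realize_ex {φ : MSOFormula L (n + 1) m} :
    φ.ex.Realize v V ↔ ∃ a : A, φ.Realize (Fin.snoc (α := fun _ => A) v a) V := by
  simp [ex]

@[simp] theorem realize_exSet {φ : MSOFormula L n (m + 1)} :
    φ.exSet.Realize v V ↔ ∃ B : Set A, φ.Realize v (Fin.snoc (α := fun _ => Set A) V B) := by
  simp [exSet]

@[simp] theorem realize_mem {x : Fin n} {X : Fin m} :
    (MSOFormula.mem x X : MSOFormula L n m).Realize v V ↔ v x ∈ V X := Iff.rfl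

@[simp] theorem realize_equal {s t : L.Term (Fin n)} :
    (MSOFormula.equal s t : MSOFormula L n m).Realize v V ↔ s.realize v = t.realize v := Iff.rfl

end Realize

end MSOFormula

open MSOFormula in
/-- The sentence expressing `RankLike`. -/
def rankSentence (C : Type u) : MSOSentence (constLang C) :=
  let e {n m : ℕ} (i j : Fin n) : MSOFormula (constLang C) n m := memT (.var i) (.var j)
  (allSet (.imp (.ex (.mem 0 0)) (.ex (.and (.mem 0 0) (.all (.imp (e 1 0) (.not (.mem 1 0)))))))).and
  ((all (.all (.imp (.all (.iff (e 2 0) (e 2 1))) (.equal (.var 0) (.var 1))))).and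
  ((all (.allSet (.imp (.all (.imp (.mem 1 0) (e 1 0))) (.ex (.all (.iff (e 2 1) (.mem 2 0))))))).and
  (exSet (.and
    (.all (.imp (.mem 0 0) (.all (.iff (e 1 0)
      (.ex (.and (.mem 2 0) (.and (e 2 0) (.all (.imp (e 3 1) (e 3 2))))))))))
    (.all (.ex (.and (.mem 1 0) (.all (.imp (e 2 0) (e 2 1))))))))))

theorem holds_rankSentence : (rankSentence C).Holds A ↔ RankLike (memInterp C (A := A)) := by
  simp only [MSOSentence.Holds, rankSentence, MSOFormula.realize_and, MSOFormula.realize_allSet,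
    MSOFormula.realize_imp, MSOFormula.realize_ex, MSOFormula.realize_mem, MSOFormula.realize_all,
    MSOFormula.realize_not, MSOFormula.realize_iff, MSOFormula.realize_memT,
    MSOFormula.realize_exSet, MSOFormula.realize_equal, Language.Term.realize_var]
  exact ⟨fun ⟨h₁, h₂, h₃, h₄⟩ => ⟨h₁, h₂, h₃, h₄⟩, fun ⟨h₁, h₂, h₃, h₄⟩ => ⟨h₁, h₂, h₃, h₄⟩⟩

/-- Terms of the language of set theory, with constants in place of the free variables. -/
def constTerm {k : ℕ} (x : Fin k → C) :
    setLang.Term (Fin k ⊕ Fin n) → (constLang C).Term (Fin n)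
  | .var (.inl i) => constT (x i)
  | .var (.inr i) => .var i
  | .func f _ => Empty.elim f

/-- The relation symbols of the language of set theory as symbols of `constLang`. -/
def constRel : {k : ℕ} → SetRel k → ConstRel.{u} k
  | _, .mem => .mem

/-- First-order formulas of set theory as second-order formulas, with constants in place of the free
variables. -/
def constFormula {k : ℕ} (x : Fin k → C) :
    {n : ℕ} → setLang.BoundedFormula (Fin k) n → MSOFormula (constLang C) n 0
  | _, .falsum => .falsum
  | _, .equal s t => .equal (constTerm x s) (constTerm x t)
  | _, .rel R ts => .rel (constRel R) fun i => constTerm x (ts i)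
  | _, .imp φ ψ => .imp (constFormula x φ) (constFormula x ψ)
  | _, .all φ => .all (constFormula x φ)

theorem realize_constFormula {U : ZFSet.{u}} (f : A ≃ U)
    (hf : ∀ a b, memInterp C a b ↔ (f a : ZFSet.{u}) ∈ (f b : ZFSet.{u})) {k : ℕ} (x : Fin k → C)
    (φ : setLang.BoundedFormula (Fin k) n) (v : Fin n → A) (V : Fin 0 → Set A) :
    (constFormula x φ).Realize v V ↔ φ.Realize (fun i => f (constInterp A (x i))) (f ∘ v) := by
  have hterm : ∀ {n} (t : setLang.Term (Fin k ⊕ Fin n)) (v : Fin n → A),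
      f ((constTerm x t).realize v) =
        t.realize (Sum.elim (fun i => f (constInterp A (x i))) (f ∘ v)) := by
    rintro n ((i | i) | ⟨g, -⟩) v
    · exact congrArg f (realize_constT _ _)
    · rfl
    · exact Empty.elim g
  induction φ with
  | falsum => exact Iff.rfl
  | equal s t =>
    change _ = _ ↔ _ = _
    rw [← hterm, ← hterm, f.injective.eq_iff]
  | rel R ts =>
    cases R
    have h := hf ((constTerm x (ts 0)).realize v) ((constTerm x (ts 1)).realize v)
    rw [hterm, hterm] at h
    refine Iff.trans (iff_of_eq (congrArg (I.RelMap (n := 2) ConstRel.mem) (funext fun i => ?_))) h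
    fin_cases i <;> rfl
  | imp φ ψ ih₁ ih₂ => exact imp_congr (ih₁ v) (ih₂ v)
  | all φ ih =>
    refine (forall_congr' fun a => ih _).trans ?_
    refine f.forall_congr fun a => iff_of_eq (congrArg _ ?_)
    funext i
    induction i using Fin.lastCases <;> simp

end Sentences

/-! ### Weak compactness implies sub-extendibility -/

section Ordinals

/-- The formula expressing that `v` is an ordinal. -/
noncomputable def ordinalF : setLang.Formula Unit :=
  allF ((memF none (some ())).imp (allF ((memF none (some none)).imp
    (memF none (some (some ())) ⊓ allF ((memF none (some none)).imp (memF none (some (some none))))))))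

theorem realize_ordinalF {U : ZFSet.{u}} (hU : U.IsTransitive) {v : Unit → U} :
    ordinalF.Realize v ↔ (v () : ZFSet.{u}).IsOrdinal := by
  simp only [ordinalF, realize_allF, Language.Formula.realize_imp, Language.Formula.realize_inf,
    realize_memF, Option.elim_none, Option.elim_some]
  rw [ZFSet.isOrdinal_iff_forall_mem_isTransitive]
  constructor
  · intro h
    have h' : ∀ x ∈ (v () : ZFSet.{u}), ∀ y ∈ x, y ∈ (v () : ZFSet.{u}) ∧ ∀ z ∈ y, z ∈ x := by
      intro x hx y hy
      have hxU := hU.mem_trans hx (v ()).2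
      have hyU := hU.mem_trans hy hxU
      obtain ⟨h₁, h₂⟩ := h ⟨x, hxU⟩ hx ⟨y, hyU⟩ hy
      exact ⟨h₁, fun z hz => h₂ ⟨z, hU.mem_trans hz hyU⟩ hz⟩
    exact ⟨fun x hx y hy => (h' x hx y hy).1, fun x hx y hy z hz => (h' x hx y hy).2 z hz⟩
  · rintro ⟨h₁, h₂⟩ x hx y hy
    exact ⟨h₁ x hx hy, fun z hz => h₂ x hx y hy hz⟩

variable {κ : Cardinal.{u}} {M : ZFSet.{u}} {θ θ' : Ordinal.{u}}

theorem isOrdinal_of_elementary (e : M ↪ₑ[setLang] (V_ θ : ZFSet.{u}))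
    (he : ∀ x : M, (e x : ZFSet.{u}) = x) (j : M ↪ₑ[setLang] (V_ θ' : ZFSet.{u})) {x : M}
    (hx : (x : ZFSet.{u}).IsOrdinal) : (j x : ZFSet.{u}).IsOrdinal := by
  have h₁ := realize_ordinalF (ZFSet.isTransitive_vonNeumann θ) (v := fun _ => e x)
  have h₂ := realize_ordinalF (ZFSet.isTransitive_vonNeumann θ') (v := fun _ => j x)
  rw [← h₂]
  rw [he] at h₁
  exact (j.map_formula ordinalF fun _ => x).2 ((e.map_formula ordinalF fun _ => x).1 (h₁.2 hx))

/-- If some element of `j(κ)` bounds `j '' κ`, then `j` has a critical point `μ ≤ κ`, and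
`sup (j '' κ) < j(κ)`. -/
theorem exists_criticalPoint (hκ : ℵ₀ ≤ κ) (hM : (κ.ord + 1).toZFSet ⊆ M)
    (e : M ↪ₑ[setLang] (V_ θ : ZFSet.{u}))
    (he : ∀ x : M, (e x : ZFSet.{u}) = x) (j : M ↪ₑ[setLang] (V_ θ' : ZFSet.{u}))
    {k : M} (hk : (k : ZFSet.{u}) = κ.ord.toZFSet) {d : ZFSet.{u}} (hd : d ∈ (j k : ZFSet.{u}))
    (hjd : ∀ x : M, (x : ZFSet.{u}) ∈ κ.ord.toZFSet → (j x : ZFSet.{u}) ∈ d) :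
    (∃ μ ≤ κ.ord, HasCriticalPoint j μ) ∧ supImage j κ.ord ∈ (j k : ZFSet.{u}) := by
  have hjk : (j k : ZFSet.{u}).IsOrdinal :=
    isOrdinal_of_elementary e he j (hk ▸ ZFSet.isOrdinal_toZFSet _)
  have hdo := hjk.mem hd
  have hsup : supImage j κ.ord ∈ (j k : ZFSet.{u}) := by
    refine ZFSet.IsOrdinal.mem_of_subset_of_mem ?_ hjk (fun y hy => ?_) hd
    · rw [ZFSet.isOrdinal_iff_forall_mem_isTransitive]
      refine ⟨.iUnion fun x => (hdo.mem (hjd x.1 x.2)).isTransitive, fun y hy => ?_⟩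
      obtain ⟨x, hx⟩ := ZFSet.mem_iUnion.1 hy
      exact ((hdo.mem (hjd x.1 x.2)).mem hx).isTransitive
    · obtain ⟨x, hx⟩ := ZFSet.mem_iUnion.1 hy
      exact hdo.mem_trans hx (hjd x.1 x.2)
  refine ⟨?_, hsup⟩
  let o : Set.Iic κ.ord → M := fun a => ⟨a.1.toZFSet, toZFSet_mem_of_le hM a.2⟩
  have hmove : ∃ a : Set.Iic κ.ord, (j (o a) : ZFSet.{u}) ≠ a.1.toZFSet := by
    by_contra! hfix
    have hjk' : (j k : ZFSet.{u}) = κ.ord.toZFSet := by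
      rw [← hfix ⟨κ.ord, le_refl κ.ord⟩, show k = o ⟨κ.ord, le_refl κ.ord⟩ from Subtype.ext hk]
    obtain ⟨a, ha, hasup⟩ := Ordinal.mem_toZFSet_iff.1 (hjk' ▸ hsup)
    have := mem_supImage j hκ hM (o ⟨a, ha.le⟩) (Ordinal.toZFSet_mem_toZFSet_iff.2 ha)
    rw [hfix, ← hasup] at this
    exact ZFSet.mem_irrefl _ this
  obtain ⟨⟨μ, hμ⟩, hμj, hmin⟩ := wellFounded_lt.has_min
    {a : Set.Iic κ.ord | (j (o a) : ZFSet.{u}) ≠ a.1.toZFSet} hmove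
  have hfix : ∀ x : M, (x : ZFSet.{u}) ∈ μ.toZFSet → (j x : ZFSet.{u}) = x := by
    intro x hx
    obtain ⟨a, ha, hax⟩ := Ordinal.mem_toZFSet_iff.1 hx
    have haκ : a ≤ κ.ord := ha.le.trans hμ
    obtain rfl : o ⟨a, haκ⟩ = x := Subtype.ext hax
    by_contra hne
    exact hmin ⟨a, haκ⟩ hne ha
  have hμmem : μ.toZFSet ∈ (j (o ⟨μ, hμ⟩) : ZFSet.{u}) := by
    refine (ZFSet.IsOrdinal.eq_or_mem_of_subset (ZFSet.isOrdinal_toZFSet μ)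
      (isOrdinal_of_elementary e he j (ZFSet.isOrdinal_toZFSet μ)) fun x hx => ?_).resolve_left
        fun h => hμj h.symm
    obtain ⟨a, ha, rfl⟩ := Ordinal.mem_toZFSet_iff.1 hx
    have := (mem_iff_of_elementary j (o ⟨a, ha.le.trans hμ⟩) (o ⟨μ, hμ⟩)).2 hx
    rwa [hfix (o ⟨a, ha.le.trans hμ⟩) hx] at this
  have hU := ZFSet.isTransitive_vonNeumann θ'
  refine ⟨μ, hμ, fun x hx => hM ?_, ?_, hfix, o ⟨μ, hμ⟩, rfl, hμmem⟩
  · exact Ordinal.toZFSet_monotone (add_le_add_left hμ 1) hx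
  · intro x hx
    have hμU := hU.mem_trans hμmem (j _).2
    rw [Ordinal.toZFSet_add_one] at hx
    rcases ZFSet.mem_insert_iff.1 hx with rfl | hx
    exacts [hμU, hU.mem_trans hx hμU]

end Ordinals

/-- A structure in the language of set theory with constants, given by a relation and by values of
the constants. -/
abbrev constStructure {C A : Type u} (R : A → A → Prop) (ι : C → A) : (constLang C).Structure A where
  funMap := fun f => match f with
    | .const c => fun _ => ι c
  RelMap := fun r => match r with
    | .mem => fun v => R (v 0) (v 1)

open MSOFormula in
/-- For regular `κ`, the elementary diagram of `M`, together with the axioms of a rank and with a new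
constant between `κ` and all ordinals below `κ`, is `< κ`-satisfiable in `V_θ`. A model of the whole
theory is a rank `V_θ'` into which `M` embeds. -/
theorem weaklySubExtendible_of_mem_WCS {κ : Cardinal.{u}} (hκ : κ.IsRegular) (h : κ ∈ WCS.{u}) :
    WeaklySubExtendible κ := by
  have hκ₀ := hκ.aleph0_le
  intro θ hθ M hMV hM hcard
  obtain ⟨e, he⟩ := hMV
  -- Constants for the elements of `M`, and a new constant `none` for a bound of `j '' κ`.
  let C : Type u := Option (Shrink.{u} M)
  let c : M → C := fun x => some (equivShrink M x)
  let k : M := ⟨κ.ord.toZFSet, toZFSet_mem_of_le hM le_rfl⟩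
  let bound : Set.Iio κ.ord → MSOSentence (constLang C) := fun a =>
    memT (constT (c ⟨a.1.toZFSet, toZFSet_mem_of_le hM (le_of_lt a.2)⟩)) (constT none)
  let T : Set (MSOSentence (constLang C)) :=
    {rankSentence C, memT (constT none) (constT (c k))} ∪
      {φ | ∃ (n : ℕ) (ψ : setLang.Formula (Fin n)) (x : Fin n → M), ψ.Realize x ∧
        φ = constFormula (c ∘ x) ψ} ∪ Set.range bound
  have hC : #C ≤ κ := by
    have : #(Shrink.{u} M) = κ := hcard
    rw [mk_option, this, add_one_eq hκ₀]
  have hsat : LTSatisfiable κ T := by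
    intro T₀ hT₀ hT₀κ
    classical
    -- Since `κ` is regular, some `δ < κ` exceeds all ordinals that `T₀` requires to be below the
    -- new constant, and `V_θ` is a model of `T₀` if that constant denotes `δ`.
    let b : T₀ → Ordinal.{u} := fun φ =>
      if hφ : ∃ a, bound a = φ then (hφ.choose : Ordinal.{u}) + 1 else 0
    have hδ : ⨆ φ, b φ < κ.ord := by
      refine Ordinal.iSup_lt_of_lt_cof (by rwa [hκ.cof_ord]) fun φ => ?_
      simp only [b]
      split_ifs with hφ
      · exact add_one_lt_ord hκ₀ hφ.choose.2
      · exact hκ.ord_pos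
    set δ := ⨆ φ, b φ
    have hδM : δ.toZFSet ∈ M := toZFSet_mem_of_le hM hδ.le
    let s := equivShrink.{u} (V_ θ : ZFSet.{u})
    let R : Shrink.{u} (V_ θ : ZFSet.{u}) → Shrink.{u} (V_ θ : ZFSet.{u}) → Prop := fun a b =>
      (s.symm a : ZFSet.{u}) ∈ (s.symm b : ZFSet.{u})
    let ι : C → Shrink.{u} (V_ θ : ZFSet.{u}) := fun o =>
      s (e (o.elim ⟨_, hδM⟩ (equivShrink M).symm))
    let I := constStructure R ι
    have hι : ∀ x, (s.symm (ι (c x)) : (V_ θ : ZFSet.{u})) = e x := fun x => by simp [ι, c]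
    have hιn : (s.symm (ι none) : ZFSet.{u}) = δ.toZFSet := by simp [ι, he]
    refine ⟨Shrink.{u} (V_ θ : ZFSet.{u}), ⟨ι none⟩, I, fun φ hφ => ?_⟩
    rcases hT₀ hφ with ((rfl | rfl) | ⟨n, ψ, x, hx, rfl⟩) | hbound
    · exact holds_rankSentence.2 (rankLike_of_equiv (θ := θ) s.symm fun a b => Iff.rfl)
    · refine realize_memT.2 ?_
      rw [realize_constT, realize_constT]
      change (s.symm (ι none) : ZFSet.{u}) ∈ (s.symm (ι (c k)) : ZFSet.{u})
      rw [hιn, hι, he]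
      exact Ordinal.toZFSet_mem_toZFSet_iff.2 hδ
    · refine (realize_constFormula s.symm (fun a b => Iff.rfl) _ _ _ _).2 ?_
      have := (e.map_formula ψ x).2 hx
      refine (iff_of_eq ?_).1 this
      unfold Language.Formula.Realize
      congr 1
      · funext i
        exact (hι (x i)).symm
      · exact Subsingleton.elim _ _
    · -- The choice in `b` may return an ordinal other than the given one, but its bounding
      -- sentence is the same.
      have hφb : ∃ a, bound a = φ := hbound
      obtain ⟨a, ha, haδ⟩ : ∃ a, bound a = φ ∧ a.1 < δ := by
        refine ⟨hφb.choose, hφb.choose_spec, ?_⟩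
        have h₁ : b ⟨φ, hφ⟩ = hφb.choose + 1 := dif_pos hφb
        exact (lt_add_one _).trans_le (h₁ ▸ Ordinal.le_iSup b ⟨φ, hφ⟩)
      rw [← ha]
      refine realize_memT.2 ?_
      rw [realize_constT, realize_constT]
      change (s.symm (ι (c _)) : ZFSet.{u}) ∈ (s.symm (ι none) : ZFSet.{u})
      rw [hιn, hι, he]
      exact Ordinal.toZFSet_mem_toZFSet_iff.2 haδ
  obtain ⟨A, -, I, hA⟩ := h.2 (constLang C) (card_constLang_le hκ₀ hC) T hsat
  obtain ⟨θ', f, hf⟩ := RankLike.exists_equiv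
    (holds_rankSentence.1 (hA _ (Or.inl (Or.inl (Or.inl rfl)))))
  have hdiag : ∀ {n : ℕ} (ψ : setLang.Formula (Fin n)) (x : Fin n → M), ψ.Realize x →
      ψ.Realize fun i => f (constInterp A (c (x i))) := by
    intro n ψ x hx
    have := (realize_constFormula f hf _ _ _ _).1
      (hA (constFormula (c ∘ x) ψ) (Or.inl (Or.inr ⟨n, ψ, x, hx, rfl⟩)))
    refine (iff_of_eq ?_).1 this
    unfold Language.Formula.Realize
    congr 1
    exact Subsingleton.elim _ _
  let j : M ↪ₑ[setLang] (V_ θ' : ZFSet.{u}) :=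
    { toFun := fun x => f (constInterp A (c x))
      map_formula' := fun n ψ x => by
        refine ⟨fun hψ => ?_, hdiag ψ x⟩
        by_contra hx
        exact hdiag ψ.not x hx hψ }
  have hmemT : ∀ a b : C, (memT (constT a) (constT b) : MSOSentence (constLang C)) ∈ T →
      (f (constInterp A a) : ZFSet.{u}) ∈ (f (constInterp A b) : ZFSet.{u}) := by
    intro a b hab
    have := realize_memT.1 (hA _ hab)
    rw [realize_constT, realize_constT] at this
    exact (hf _ _).1 this
  obtain ⟨hμ, hsup⟩ := exists_criticalPoint hκ₀ hM e he j (k := k) rfl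
    (d := f (constInterp A none)) (hmemT _ _ (Or.inl (Or.inl (Or.inr rfl)))) fun x hx => by
      obtain ⟨a, ha, hax⟩ := Ordinal.mem_toZFSet_iff.1 hx
      obtain rfl : ⟨a.toZFSet, toZFSet_mem_of_le hM ha.le⟩ = x := Subtype.ext hax
      exact hmemT _ _ (Or.inr ⟨⟨a, ha⟩, rfl⟩)
  exact ⟨θ', j, hμ, k, rfl, hsup⟩

end WeakCompactness

theorem theorem2p3 (κ : Cardinal.{u}) (hκ : ℵ₀ ≤ κ) :
    (κ.IsRegular → (κ ∈ WeakCompactness.WCS.{u} ↔ WeakCompactness.WeaklySubExtendible κ)) ∧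
      (WeakCompactness.WeaklySubExtendible κ → κ ∈ WeakCompactness.WCS.{u}) :=
  ⟨fun hreg => ⟨WeakCompactness.weaklySubExtendible_of_mem_WCS hreg,
    WeakCompactness.WeaklySubExtendible.mem_WCS hκ⟩, WeakCompactness.WeaklySubExtendible.mem_WCS hκ⟩
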